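/- Let $\mathfrak k$ be a finite-dimensional real inner product space (for instance the Lie algebra of a compact connected Lie group $K$ with an $\mathrm{Ad}$-$K$-invariant inner product). Let $\mathcal A=L^2([0,1];\mathfrak k)$ (Lebesgue measure). Let $W(\mathfrak k)$ be the space of continuous paths $a:[0,1]\to\mathfrak k$ with $a_0=0$, let $\bar{\mathcal A}=\{da_\tau/d\tau : a\in W(\mathfrak k)\}$ be the space of their distributional derivatives, a Banach space under the supremum norm of $a$, which contains $\mathcal A$, and let $\bar{\mathcal A}_{\mathbb C}=\bar{\mathcal A}+i\bar{\mathcal A}$. Fix $s,t$ with $s>t/2>0$ and put $r=2(s-t/2)$. For a continuous linear functional $\phi$ on $\bar{\mathcal A}$ let $\|\phi\|$ be its norm as a linear functional on $\mathcal A$. Then there is a unique Gaussian measure $\tilde P_s$ on $\bar{\mathcal A}$ and a unique Gaussian measure $\tilde M_{s,t}$ on $\bar{\mathcal A}_{\mathbb C}$ such that, for all continuous linear functionals $\phi,\psi$ on $\bar{\mathcal A}$, $$\int_{\bar{\mathcal A}} e^{i\phi(A)}\,d\tilde P_s(A)=e^{-\frac s2\|\phi\|^2},\qquad \int_{\bar{\mathcal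 A}_{\mathbb C}} e^{i\phi(A)+i\psi(B)}\,d\tilde M_{s,t}(A+iB)=e^{-\frac14(r\|\phi\|^2+t\|\psi\|^2)}.$$ Call a finite orthonormal set $\{e_1,\dots,e_d\}$ in $\mathcal A$ admissible if each functional $\langle e_j,\cdot\rangle$ extends continuously to $\bar{\mathcal A}$; the extension is again written $\langle e_j,\cdot\rangle$, and so is its complex-linear extension to $\bar{\mathcal A}_{\mathbb C}$. Let $\mathcal HL^2(\bar{\mathcal A}_{\mathbb C},\tilde M_{s,t})$ be the closure in $L^2(\bar{\mathcal A}_{\mathbb C},\tilde M_{s,t})$ of the set of square-integrable functions of the form $C\mapsto\Phi(\langle e_1,C\rangle,\dots,\langle e_d,C\rangle)$ with $\{e_1,\dots,e_d\}$ admissible and $\Phi$ holomorphic on $\mathbb C^d$. For $\phi$ on $\mathbb R^d$ and $z\in\mathbb C^d$ put $$S_{s,t}\phi(z)=\int_{\mathbb R^d}(2\pi t)^{-d/2}e^{-\sum_k (z_k-x_k)^2/2t}\,\phi(x)\,dx .$$ **Theorem 4.3.** There is a unique linear isometry $\tilde S_{s,t}$ of $L^2(\bar{\mathcal A},\tilde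 P_s)$ (complex-valued functions) onto $\mathcal HL^2(\bar{\mathcal A}_{\mathbb C},\tilde M_{s,t})$ such that for every admissible set $\{e_1,\dots,e_d\}$ and every measurable $\phi:\mathbb R^d\to\mathbb C$ for which $f(A)=\phi(\langle e_1,A\rangle,\dots,\langle e_d,A\rangle)$ is in $L^2(\bar{\mathcal A},\tilde P_s)$, $$\tilde S_{s,t}f(C)=(S_{s,t}\phi)(\langle e_1,C\rangle,\dots,\langle e_d,C\rangle)\qquad\text{for }\tilde M_{s,t}\text{-almost every } C.$$ -/

import Mathlib

open MeasureTheory ProbabilityTheory Set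
open scoped Distributions LineDeriv ContDiff

noncomputable section

namespace WienerSB

section Spaces

variable (V : Type*) [NormedAddCommGroup V] [InnerProductSpace ℝ V] [FiniteDimensional ℝ V]

/-- Lebesgue measure on `[0,1]`. -/
abbrev lebesgue01 : Measure ℝ := volume.restrict (Icc (0 : ℝ) 1)

/-- The Hilbert space `𝒜 = L²([0,1]; V)`. -/
abbrev ConnL2 : Type _ := Lp V 2 lebesgue01

/-- `W(V)`: continuous paths `a : [0,1] → V` with `a 0 = 0`, with the supremum norm. -/
def Paths : Submodule ℝ C(unitInterval, V) where
  carrier := {a | a 0 = 0}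
  add_mem' {a b} ha hb := by
    simp only [mem_ofPred_eq] at ha hb ⊢
    simp [ha, hb]
  zero_mem' := rfl
  smul_mem' c a ha := by
    simp only [mem_ofPred_eq] at ha ⊢
    simp [ha]

/-- The open interval `(0,1)`. -/
def openUnit : TopologicalSpace.Opens ℝ := ⟨Ioo (0 : ℝ) 1, isOpen_Ioo⟩

variable {V}

/-- The continuous extension to `ℝ` (constant on both sides) of a path on `[0,1]`. -/
def extendPath (a : C(unitInterval, V)) : ℝ → V := IccExtend zero_le_one a

lemma continuous_extendPath (a : C(unitInterval, V)) : Continuous (extendPath a) :=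
  a.continuous.Icc_extend'

lemma locallyIntegrableOn_extendPath (a : C(unitInterval, V)) (U : Set ℝ) :
    LocallyIntegrableOn (extendPath a) U volume :=
  (continuous_extendPath a).locallyIntegrable.locallyIntegrableOn U

lemma integrable_smul_extendPath (a : C(unitInterval, V)) (χ : 𝓓(openUnit, ℝ)) :
    Integrable (fun τ => χ τ • extendPath a τ) :=
  TestFunction.integrable_bilin (ContinuousLinearMap.lsmul ℝ ℝ)
    (locallyIntegrableOn_extendPath a _) χ

/-- A continuous path viewed as the `V`-valued distribution `χ ↦ ∫ χ(τ) a(τ) dτ` on `(0,1)`. -/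
def pathDistribution : C(unitInterval, V) →ₗ[ℝ] 𝓓'(openUnit, V) where
  toFun a := (TestFunction.integralAgainstBilinCLM (ContinuousLinearMap.lsmul ℝ ℝ) volume
    (extendPath a) : 𝓓(openUnit, ℝ) →L[ℝ] V)
  map_add' a b := by
    refine ContinuousLinearMap.ext fun χ => ?_
    change TestFunction.integralAgainstBilinCLM (ContinuousLinearMap.lsmul ℝ ℝ) volume
        (extendPath (a + b)) χ =
      TestFunction.integralAgainstBilinCLM (ContinuousLinearMap.lsmul ℝ ℝ) volume
        (extendPath a) χ +
      TestFunction.integralAgainstBilinCLM (ContinuousLinearMap.lsmul ℝ ℝ) volume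
        (extendPath b) χ
    simp only [TestFunction.integralAgainstBilinCLM_eq_integral
      (locallyIntegrableOn_extendPath _ _)]
    simp only [ContinuousLinearMap.lsmul_apply]
    rw [← integral_add (integrable_smul_extendPath _ χ) (integrable_smul_extendPath _ χ)]
    exact integral_congr_ae (Filter.Eventually.of_forall fun τ => smul_add _ _ _)
  map_smul' c a := by
    refine ContinuousLinearMap.ext fun χ => ?_
    change TestFunction.integralAgainstBilinCLM (ContinuousLinearMap.lsmul ℝ ℝ) volume
        (extendPath (c • a)) χ =
      c • TestFunction.integralAgainstBilinCLM (ContinuousLinearMap.lsmul ℝ ℝ) volume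
        (extendPath a) χ
    simp only [TestFunction.integralAgainstBilinCLM_eq_integral
      (locallyIntegrableOn_extendPath _ _)]
    rw [← integral_smul]
    exact integral_congr_ae (Filter.Eventually.of_forall fun τ => smul_comm _ _ _)

lemma pathDistribution_apply (a : C(unitInterval, V)) (χ : 𝓓(openUnit, ℝ)) :
    pathDistribution a χ = ∫ τ, χ τ • extendPath a τ :=
  TestFunction.integralAgainstBilinCLM_eq_integral (locallyIntegrableOn_extendPath a _)

/-- The distributional derivative `a ↦ da/dτ` on `W(V)`. -/
def pathDeriv : Paths V →ₗ[ℝ] 𝓓'(openUnit, V) :=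
  (LineDeriv.lineDerivOpCLM ℝ 𝓓'(openUnit, V) (1 : ℝ)).toLinearMap ∘ₗ pathDistribution ∘ₗ
    (Paths V).subtype

lemma pathDeriv_apply (a : Paths V) (χ : 𝓓(openUnit, ℝ)) :
    pathDeriv a χ = - ∫ τ, deriv χ τ • extendPath (a : C(unitInterval, V)) τ := by
  change (∂_{(1 : ℝ)} (pathDistribution (a : C(unitInterval, V)))) χ = _
  rw [Distribution.lineDerivOp_apply_apply, map_neg, pathDistribution_apply]
  congr 1

/-- An element `A = da/dτ` determines the path `a`. -/
lemma pathDeriv_injective : Function.Injective (pathDeriv : Paths V →ₗ[ℝ] 𝓓'(openUnit, V)) := by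
  have : CompleteSpace V := FiniteDimensional.complete ℝ V
  rw [injective_iff_map_eq_zero]
  intro a ha
  set f : ℝ → V := extendPath (a : C(unitInterval, V)) with hf
  have hfc : Continuous f := continuous_extendPath _
  -- the distributional derivative vanishes
  have h0 : ∀ g : ℝ → ℝ, ContDiff ℝ ∞ g → HasCompactSupport g → tsupport g ⊆ Ioo 0 1 →
      ∫ τ, deriv g τ • f τ = 0 := by
    intro g hg hgc hgs
    have h := pathDeriv_apply a ⟨g, hg, hgc, hgs⟩
    rw [ha] at h
    exact neg_eq_zero.mp h.symm
  -- a normalised bump function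
  obtain ⟨η, hη, hηc, hηs, hη1⟩ : ∃ η : ℝ → ℝ, ContDiff ℝ ∞ η ∧ HasCompactSupport η ∧
      tsupport η ⊆ Ioo 0 1 ∧ ∫ τ, η τ = 1 := by
    let b : ContDiffBump (1 / 2 : ℝ) := ⟨1 / 8, 1 / 4, by norm_num, by norm_num⟩
    refine ⟨b.normed volume, b.contDiff_normed, b.hasCompactSupport_normed, ?_,
      b.integral_normed⟩
    rw [b.tsupport_normed_eq, Real.closedBall_eq_Icc]
    refine Icc_subset_Ioo ?_ ?_ <;> norm_num [b]
  -- a test function of mean zero is the derivative of a test function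
  have h1 : ∀ g : ℝ → ℝ, ContDiff ℝ ∞ g → HasCompactSupport g → tsupport g ⊆ Ioo 0 1 →
      ∫ τ, g τ = 0 → ∫ τ, g τ • f τ = 0 := by
    intro g hg hgc hgs hg0
    obtain ⟨G, hG⟩ : ∃ G : ℝ → ℝ, ∀ x, G x = ∫ y in (0 : ℝ)..x, g y := ⟨_, fun _ => rfl⟩
    have hGd : ∀ x, HasDerivAt G (g x) x := by
      intro x
      have := intervalIntegral.integral_hasDerivAt_right
        (hg.continuous.intervalIntegrable 0 x)
        (hg.continuous.stronglyMeasurableAtFilter _ _) hg.continuous.continuousAt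
      exact this.congr_of_eventuallyEq (Filter.Eventually.of_forall hG)
    have hdG : deriv G = g := funext fun x => (hGd x).deriv
    have hGs : ContDiff ℝ ∞ G := by
      rw [contDiff_infty_iff_deriv, hdG]
      exact ⟨fun x => (hGd x).differentiableAt, hg⟩
    obtain ⟨u, v, hu, hv, huv⟩ : ∃ u v : ℝ, 0 < u ∧ v < 1 ∧ tsupport g ⊆ Icc u v := by
      rcases (tsupport g).eq_empty_or_nonempty with he | hne
      · exact ⟨1 / 2, 1 / 2, by norm_num, by norm_num, by simp [he]⟩
      · have hc : IsCompact (tsupport g) := hgc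
        obtain ⟨u, hu, hu'⟩ := hc.exists_isLeast hne
        obtain ⟨v, hv, hv'⟩ := hc.exists_isGreatest hne
        exact ⟨u, v, (hgs hu).1, (hgs hv).2, fun x hx => ⟨hu' hx, hv' hx⟩⟩
    have hg' : ∀ x, x ∉ Icc u v → g x = 0 := fun x hx =>
      image_eq_zero_of_notMem_tsupport fun h => hx (huv h)
    have hGz : ∀ x, x ∉ Icc u v → G x = 0 := by
      intro x hx
      by_cases hxu : x < u
      · rw [hG]
        refine intervalIntegral.integral_zero_ae (Filter.Eventually.of_forall fun y hy => ?_)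
        refine hg' y fun h => ?_
        rcases le_total 0 x with h0 | h0
        · rw [uIoc_of_le h0] at hy; linarith [hy.2, h.1]
        · rw [uIoc_of_ge h0] at hy; linarith [hy.2, h.1]
      · have hxv : v < x := by
          by_contra h
          exact hx ⟨not_lt.mp hxu, not_lt.mp h⟩
        have : ∫ y in (0 : ℝ)..x, g y = ∫ y, g y := by
          refine intervalIntegral.integral_eq_integral_of_support_subset ?_
          intro y hy
          by_contra hn
          refine hy (hg' y fun h => hn ⟨by linarith [h.1], by linarith [h.2]⟩)
        rw [hG, this, hg0]
    have hGt : tsupport G ⊆ Icc u v := by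
      refine closure_minimal (fun x hx => ?_) isClosed_Icc
      by_contra h
      exact hx (hGz x h)
    have := h0 G hGs (isCompact_Icc.of_isClosed_subset (isClosed_tsupport G) hGt)
      (hGt.trans (Icc_subset_Ioo hu hv))
    rwa [hdG] at this
  have hint : ∀ g : ℝ → ℝ, ContDiff ℝ ∞ g → HasCompactSupport g →
      ∀ F : ℝ → V, Continuous F → Integrable (fun τ => g τ • F τ) := fun g hg hgc F hF =>
    (hg.continuous.smul hF).integrable_of_hasCompactSupport hgc.smul_right
  -- hence the path is constant
  set c : V := ∫ τ, η τ • f τ with hc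
  have h2 : ∀ᵐ x : ℝ, x ∈ Ioo (0 : ℝ) 1 → f x - c = 0 := by
    refine isOpen_Ioo.ae_eq_zero_of_integral_contDiff_smul_eq_zero
      ((hfc.sub continuous_const).locallyIntegrable.locallyIntegrableOn _) ?_
    intro g hg hgc hgs
    have hgi : Integrable g := hg.continuous.integrable_of_hasCompactSupport hgc
    have hηi : Integrable η := hη.continuous.integrable_of_hasCompactSupport hηc
    have key := h1 (fun x => g x - (∫ y, g y) * η x) (hg.sub (contDiff_const.mul hη))
      (hgc.sub hηc.mul_left) ?_ ?_
    · simp only [sub_smul, mul_smul] at key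
      have hI := (hint η hη hηc f hfc).smul (∫ y, g y)
      rw [integral_sub (hint g hg hgc f hfc) (hI : Integrable (fun τ => (∫ y, g y) • η τ • f τ)), integral_smul,
        ← hc] at key
      simp only [smul_sub]
      rw [integral_sub (hint g hg hgc f hfc) (hint g hg hgc _ continuous_const),
        integral_smul_const, key]
    · refine (tsupport_sub _ _).trans (union_subset hgs ?_)
      exact (closure_mono (Function.support_const_smul_subset (∫ y, g y) η)).trans hηs
    · rw [integral_sub hgi (hηi.const_mul _), integral_const_mul, hη1, mul_one, sub_self]
  have h3 : EqOn f (fun _ => c) (Icc 0 1) := by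
    have h4 : EqOn f (fun _ => c) (Ioo 0 1) := by
      refine Measure.eqOn_open_of_ae_eq (μ := (volume : Measure ℝ)) ?_ isOpen_Ioo
        hfc.continuousOn continuousOn_const
      exact (ae_restrict_iff' measurableSet_Ioo).2 (h2.mono fun x hx h => sub_eq_zero.mp (hx h))
    have := h4.closure hfc continuous_const
    rwa [closure_Ioo zero_ne_one] at this
  ext τ
  have e : ∀ σ : unitInterval, (a : C(unitInterval, V)) σ = c := fun σ => by
    have h := h3 σ.2
    rwa [hf, extendPath, IccExtend_val] at h
  have a0 : (a : C(unitInterval, V)) 0 = 0 := a.2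
  rw [e τ, ← e 0, a0]
  rfl

variable (V) in
/-- `Ā`: the `V`-valued distributions on `(0,1)` of the form `da/dτ` with `a ∈ W(V)`. -/
def Abar : Type _ := LinearMap.range (pathDeriv : Paths V →ₗ[ℝ] 𝓓'(openUnit, V))

instance : AddCommGroup (Abar V) :=
  inferInstanceAs (AddCommGroup (LinearMap.range (pathDeriv : Paths V →ₗ[ℝ] 𝓓'(openUnit, V))))

instance : Module ℝ (Abar V) :=
  inferInstanceAs (Module ℝ (LinearMap.range (pathDeriv : Paths V →ₗ[ℝ] 𝓓'(openUnit, V))))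

variable (V) in
/-- The distribution underlying an element of `Ā`. -/
def Abar.toDistribution : Abar V →ₗ[ℝ] 𝓓'(openUnit, V) :=
  (LinearMap.range (pathDeriv : Paths V →ₗ[ℝ] 𝓓'(openUnit, V))).subtype

variable (V) in
/-- The linear bijection `a ↦ da/dτ` from `W(V)` onto `Ā`. -/
def Abar.ofPath : Paths V ≃ₗ[ℝ] Abar V :=
  LinearEquiv.ofInjective pathDeriv pathDeriv_injective

lemma Abar.toDistribution_ofPath (a : Paths V) :
    Abar.toDistribution V (Abar.ofPath V a) = pathDeriv a := rfl

/-- The norm of `A = da/dτ` is the supremum norm of `a`. -/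
instance : NormedAddCommGroup (Abar V) :=
  NormedAddCommGroup.induced (Abar V) (Paths V) (Abar.ofPath V).symm (Abar.ofPath V).symm.injective

instance : NormedSpace ℝ (Abar V) :=
  NormedSpace.induced ℝ (Abar V) (Paths V) (Abar.ofPath V).symm

instance : MeasurableSpace (Abar V) := borel (Abar V)

instance : BorelSpace (Abar V) := ⟨rfl⟩

variable (V) in
/-- The isometric identification of `W(V)` with `Ā`. -/
def Abar.pathEquiv : Paths V ≃ₗᵢ[ℝ] Abar V where
  toLinearEquiv := Abar.ofPath V
  norm_map' a := by
    change ‖(Abar.ofPath V).symm (Abar.ofPath V a)‖ = ‖a‖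
    rw [LinearEquiv.symm_apply_apply]

/-- `Ā_ℂ = Ā + iĀ`, the derivatives `dc/dτ` of continuous paths `c = a + ib` with values in
`V + iV`; the pair `(A, B)` stands for `A + iB`. -/
abbrev AbarC (V : Type*) [NormedAddCommGroup V] [InnerProductSpace ℝ V]
    [FiniteDimensional ℝ V] : Type _ := Abar V × Abar V

lemma integrable_connL2 (f : ConnL2 V) : Integrable f lebesgue01 :=
  (Lp.memLp f).integrable (by norm_num)

lemma integrableOn_connL2 (f : ConnL2 V) : IntegrableOn f (Icc 0 1) volume :=
  integrable_connL2 f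

lemma intervalIntegrable_connL2 (f : ConnL2 V) (τ : unitInterval) :
    IntervalIntegrable f volume 0 τ := by
  rw [intervalIntegrable_iff_integrableOn_Ioc_of_le τ.2.1]
  exact (integrableOn_connL2 f).mono_set fun x hx => ⟨hx.1.le, hx.2.trans τ.2.2⟩

/-- The indefinite integral `τ ↦ ∫₀^τ f(σ) dσ` of `f ∈ L²([0,1]; V)`. -/
def primitive (f : ConnL2 V) : Paths V :=
  ⟨⟨fun τ => ∫ σ in (0 : ℝ)..τ, f σ, by
    have h : ContinuousOn (fun x => ∫ σ in (0 : ℝ)..x, f σ) (Icc 0 1) := by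
      have := intervalIntegral.continuousOn_primitive_interval (a := (0 : ℝ)) (b := 1)
        (f := f) (μ := volume) (by rw [uIcc_of_le zero_le_one]; exact integrableOn_connL2 f)
      rwa [uIcc_of_le zero_le_one] at this
    exact continuousOn_iff_continuous_domRestrict.mp h⟩, by
    change ∫ σ in (0 : ℝ)..((0 : unitInterval) : ℝ), f σ = 0
    simp⟩

lemma primitive_apply (f : ConnL2 V) (τ : unitInterval) :
    (primitive f : C(unitInterval, V)) τ = ∫ σ in (0 : ℝ)..τ, f σ := rfl

lemma norm_primitive_le (f : ConnL2 V) : ‖primitive f‖ ≤ ‖f‖ := by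
  change ‖(primitive f : C(unitInterval, V))‖ ≤ ‖f‖
  rw [ContinuousMap.norm_le _ (norm_nonneg _)]
  intro τ
  have : IsProbabilityMeasure lebesgue01 := ⟨by simp⟩
  calc ‖∫ σ in (0 : ℝ)..τ, f σ‖ ≤ ∫ σ in (0 : ℝ)..τ, ‖f σ‖ :=
        intervalIntegral.norm_integral_le_integral_norm τ.2.1
    _ ≤ ∫ σ, ‖f σ‖ ∂lebesgue01 := by
        rw [intervalIntegral.integral_of_le τ.2.1]
        refine setIntegral_mono_set (integrableOn_connL2 f).norm
          (Filter.Eventually.of_forall fun _ => norm_nonneg _) (LE.le.eventuallyLE ?_)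
        exact fun x hx => ⟨hx.1.le, hx.2.trans τ.2.2⟩
    _ ≤ ‖f‖ := by
        rw [integral_norm_eq_lintegral_enorm (Lp.aestronglyMeasurable f), Lp.norm_def,
          ← eLpNorm_one_eq_lintegral_enorm]
        exact ENNReal.toReal_mono (Lp.eLpNorm_ne_top f)
          (eLpNorm_le_eLpNorm_of_exponent_le (by norm_num) (Lp.aestronglyMeasurable f))

variable (V) in
/-- The inclusion `𝒜 ⊆ Ā`: a square-integrable function is the derivative of its indefinite
integral. -/
def inclL2 : ConnL2 V →L[ℝ] Abar V :=
  (Abar.pathEquiv V).toContinuousLinearEquiv.toContinuousLinearMap ∘L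
    LinearMap.mkContinuous
      { toFun := primitive
        map_add' := fun f g => by
          ext τ
          change ∫ σ in (0 : ℝ)..τ, (f + g) σ = (∫ σ in (0 : ℝ)..τ, f σ) + ∫ σ in (0 : ℝ)..τ, g σ
          rw [← intervalIntegral.integral_add (intervalIntegrable_connL2 f τ)
            (intervalIntegrable_connL2 g τ)]
          refine intervalIntegral.integral_congr_ae ?_
          have h := (ae_restrict_iff' measurableSet_Icc).1 (Lp.coeFn_add f g)
          filter_upwards [h] with x hx hx'
          rw [uIoc_of_le τ.2.1] at hx'
          exact hx ⟨hx'.1.le, hx'.2.trans τ.2.2⟩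
        map_smul' := fun c f => by
          ext τ
          change ∫ σ in (0 : ℝ)..τ, (c • f) σ = c • ∫ σ in (0 : ℝ)..τ, f σ
          rw [← intervalIntegral.integral_smul]
          refine intervalIntegral.integral_congr_ae ?_
          have h := (ae_restrict_iff' measurableSet_Icc).1 (Lp.coeFn_smul c f)
          filter_upwards [h] with x hx hx'
          rw [uIoc_of_le τ.2.1] at hx'
          exact hx ⟨hx'.1.le, hx'.2.trans τ.2.2⟩ }
      1 (fun f => by rw [one_mul]; exact norm_primitive_le f)

lemma inclL2_apply (f : ConnL2 V) : inclL2 V f = Abar.pathEquiv V (primitive f) := rfl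

/-- `P` is the Gaussian measure on `Ā` with Fourier transform `φ ↦ exp(-s‖φ‖²/2)`, where `‖φ‖` is
the norm of `φ` as a linear functional on `𝒜`. -/
def IsWhiteNoise (s : ℝ) (P : Measure (Abar V)) : Prop :=
  IsGaussian P ∧ ∀ φ : Abar V →L[ℝ] ℝ,
    ∫ A, Complex.exp (Complex.I * φ A) ∂P = Real.exp (-(s / 2) * ‖φ ∘L inclL2 V‖ ^ 2)

/-- `M` is the Gaussian measure on `Ā_ℂ` with Fourier transform
`(φ, ψ) ↦ exp(-(r‖φ‖² + t‖ψ‖²)/4)`, `r = 2(s - t/2)`, where the norms are those of linear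
functionals on `𝒜`. -/
def IsComplexWhiteNoise (s t : ℝ) (M : Measure (AbarC V)) : Prop :=
  IsGaussian M ∧ ∀ φ ψ : Abar V →L[ℝ] ℝ,
    ∫ C, Complex.exp (Complex.I * φ C.1 + Complex.I * ψ C.2) ∂M =
      Real.exp (-(1 / 4) *
        (2 * (s - t / 2) * ‖φ ∘L inclL2 V‖ ^ 2 + t * ‖ψ ∘L inclL2 V‖ ^ 2))

/-- `e₁, …, e_d` is an orthonormal set in `𝒜`, and `ℓ_j` is the continuous extension of the
functional `⟨e_j, ·⟩` from `𝒜` to `Ā`. -/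
def IsFrame {d : ℕ} (e : Fin d → ConnL2 V) (ℓ : Fin d → (Abar V →L[ℝ] ℝ)) : Prop :=
  Orthonormal ℝ e ∧ ∀ j f, ℓ j (inclL2 V f) = inner ℝ (e j) f

/-- The vector `(ℓ₁(A), …, ℓ_d(A))`. -/
def frameEval {d : ℕ} (ℓ : Fin d → (Abar V →L[ℝ] ℝ)) (A : Abar V) : Fin d → ℝ := fun j => ℓ j A

/-- The complex-linear extensions `ℓ_j(A + iB) = ℓ_j(A) + i ℓ_j(B)`. -/
def frameEvalC {d : ℕ} (ℓ : Fin d → (Abar V →L[ℝ] ℝ)) (C : AbarC V) : Fin d → ℂ :=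
  fun j => (ℓ j C.1 : ℂ) + Complex.I * (ℓ j C.2 : ℂ)

end Spaces

section FiniteDim

variable {d : ℕ}

/-- The analytic continuation to `ℂ^d` of the heat kernel `(2πt)^{-d/2} exp(-x²/2t)`. -/
def heatKernel (t : ℝ) (z : Fin d → ℂ) : ℂ :=
  (((2 * Real.pi * t) ^ (-(d : ℝ) / 2) : ℝ) : ℂ) * Complex.exp (-(∑ k, z k ^ 2) / (2 * t))

/-- The finite-dimensional transform `(S_{s,t} φ)(z) = ∫ P_t(z - x) φ(x) dx`; the parameter `s`
only enters through the domain `L²(ℝ^d, P_s)`. -/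
def segalBargmann (t : ℝ) (φ : (Fin d → ℝ) → ℂ) (z : Fin d → ℂ) : ℂ :=
  ∫ x : Fin d → ℝ, heatKernel t (fun k => z k - x k) * φ x

end FiniteDim

/-- The holomorphic subspace of `L²(Ā_ℂ, M)`: the `L²` closure of the square-integrable
holomorphic cylinder functions. -/
def holomorphicL2 {V : Type*} [NormedAddCommGroup V] [InnerProductSpace ℝ V]
    [FiniteDimensional ℝ V] (M : Measure (AbarC V)) : Set (Lp ℂ 2 M) :=
  closure {F | ∃ (d : ℕ) (e : Fin d → ConnL2 V) (ℓ : Fin d → (Abar V →L[ℝ] ℝ))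
    (Φ : (Fin d → ℂ) → ℂ), IsFrame e ℓ ∧ Differentiable ℂ Φ ∧
      F =ᵐ[M] fun C => Φ (frameEvalC ℓ C)}

end WienerSB

end

/-!
# The Segal–Bargmann transform for white noise

The transform is determined by its values on characters. A continuous functional `φ` on `Ā` has a
norm `‖φ‖` as a functional on `𝒜`, and for `C = A + iB` the transform of `A ↦ exp (i φ(A))` has to
be `C ↦ exp (i φ(C) - t ‖φ‖² / 2)`. By the Gaussian Fourier and Laplace transforms both families
have the same inner products, `exp (-s ‖φ - ψ‖² / 2)` (`inner_holomorphicChar`). Characters are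
total in `L²` of a finite measure (`topologicalClosure_span_charLp`), so there is exactly one
isometry with these values, and its range is the closed span of the images
(`exists_linearIsometry_of_inner_eq`).

*Cylinder functions.* That the isometry is given by the heat kernel on all cylinder functions
(`apply_cylinder`) follows by closedness: at a fixed point the integral transform is an inner
product with an element of `L²` of the Gaussian measure on `ℝ^d`, and a relation
`(T f)(p) = ⟪h p, f⟫` for almost every `p` is preserved under limits of `f`
(`isClosed_evalSubmodule`), so it suffices to have it for characters.

*The range.* A finite family of functionals can be written in one frame, up to functionals of norm
zero on `𝒜`, which vanish almost everywhere (`exists_frame`, `IsWhiteNoise.ae_eq_zero`); hence the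
range lies in the holomorphic subspace. For the converse, a Gaussian cylinder function is sent to a
multiple of the reproducing kernel of the finite-dimensional holomorphic space
(`exists_apply_eq_pairKernel`). The reproducing formula (`integral_pairKernel_mul`) is the mean
value property of entire functions, used in polar form and after a translation. It shows that
these kernels span a dense subspace of the holomorphic cylinder functions of a given frame
(`IsFrame.mem_closure_span_pairKernel`), without any approximation by polynomials.

*The measures.* Uniqueness is the uniqueness of Fourier transforms. For existence,
`exists_wienerMeasure` carries out the Lévy–Ciesielski construction: the Haar functions of `L²([0,1]; V)` receive
independent standard Gaussian coefficients, and the part of order `n` is small in the supremum norm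
of the primitive because the tent functions of order `n` have disjoint supports. The covariance of
the sum is identified through the dyadic energies of a path, which exhaust the `L²` norm of its
derivative. Complex white noise is the product of two independent real ones
(`isComplexWhiteNoise_iff`).
-/

open MeasureTheory ProbabilityTheory Set
open scoped Distributions LineDeriv ContDiff

noncomputable section

namespace WienerSB

/-! ### Isometries and evaluation relations in `L²`; characters -/

section HilbertSpace

open scoped InnerProductSpace ComplexConjugate
open BoundedContinuousFunction (probCharDual probCharDual_apply)

variable {ι H K : Type*} [NormedAddCommGroup H] [InnerProductSpace ℂ H]
  [NormedAddCommGroup K] [InnerProductSpace ℂ K]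

/-- Equal Gram matrices make `∑ c_i u_i ↦ ∑ c_i v_i` well defined and isometric; it extends to the
closed span. -/
theorem exists_linearIsometry_of_inner_eq [CompleteSpace H] [CompleteSpace K]
    (u : ι → H) (v : ι → K)
    (huv : ∀ i j, ⟪u i, u j⟫_ℂ = ⟪v i, v j⟫_ℂ)
    (hu : (Submodule.span ℂ (range u)).topologicalClosure = ⊤) :
    ∃ S : H →ₗᵢ[ℂ] K, (∀ i, S (u i) = v i) ∧
      range S = closure (Submodule.span ℂ (range v) : Set K) := by
  set U := Finsupp.linearCombination ℂ u
  set W := Finsupp.linearCombination ℂ v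
  have hin : ∀ x y, ⟪U x, U y⟫_ℂ = ⟪W x, W y⟫_ℂ := by
    intro x y
    simp only [U, W, Finsupp.linearCombination_apply, Finsupp.sum, sum_inner, inner_sum,
      inner_smul_left, inner_smul_right, huv]
  have hnorm : ∀ x, ‖W x‖ = ‖U x‖ := by
    intro x
    have h := hin x x
    rw [inner_self_eq_norm_sq_to_K, inner_self_eq_norm_sq_to_K] at h
    have h2 : ‖U x‖ ^ 2 = ‖W x‖ ^ 2 := by exact_mod_cast h
    exact ((pow_left_inj₀ (norm_nonneg _) (norm_nonneg _) two_ne_zero).1 h2).symm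
  have hrU : (LinearMap.range U : Submodule ℂ H) = Submodule.span ℂ (range u) :=
    Finsupp.range_linearCombination ℂ
  have hrW : (LinearMap.range W : Submodule ℂ K) = Submodule.span ℂ (range v) :=
    Finsupp.range_linearCombination ℂ
  have hdense : DenseRange U := by
    have h : Dense ((Submodule.span ℂ (range u) : Submodule ℂ H) : Set H) :=
      Submodule.dense_iff_topologicalClosure_eq_top.2 hu
    rw [← hrU] at h
    exact h
  set T : H →L[ℂ] K := W.extendOfNorm U
  have hT : ∀ x, T (U x) = W x :=
    LinearMap.extendOfNorm_eq hdense ⟨1, fun x => by rw [hnorm, one_mul]⟩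
  have hTn : ∀ x, ‖T x‖ = ‖x‖ := fun x =>
    hdense.induction_on (p := fun x => ‖T x‖ = ‖x‖) x
      (isClosed_eq (by fun_prop) (by fun_prop)) (fun x => by rw [hT, hnorm])
  let S : H →ₗᵢ[ℂ] K := ⟨T.toLinearMap, hTn⟩
  have hS : ∀ x, S (U x) = W x := hT
  refine ⟨S, fun i => ?_, ?_⟩
  · simpa [U, W] using hS (Finsupp.single i 1)
  · have hSd : S '' range U = (Submodule.span ℂ (range v) : Set K) := by
      rw [← hrW, ← range_comp]
      exact congrArg range (funext hS)
    refine Subset.antisymm ?_ ?_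
    · rw [← hSd, ← image_univ, ← hdense.closure_range]
      exact image_closure_subset_closure_image S.continuous
    · refine closure_minimal ?_ S.isometry.isClosedEmbedding.isClosed_range
      rw [← hSd]
      exact image_subset_range _ _

/-- The vectors `f` for which `T f` is given almost everywhere by the inner products of `f` with
the vectors `h p`. -/
def evalSubmodule {Ω : Type*} [MeasurableSpace Ω] {M : Measure Ω} (T : H →L[ℂ] Lp ℂ 2 M)
    (h : Ω → H) : Submodule ℂ H where
  carrier := {f | T f =ᵐ[M] fun p => ⟪h p, f⟫_ℂ}
  zero_mem' := by
    change T 0 =ᵐ[M] _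
    rw [map_zero]
    filter_upwards [Lp.coeFn_zero ℂ 2 M] with p hp
    rw [inner_zero_right]
    exact hp
  add_mem' {f g} hf hg := by
    change T (f + g) =ᵐ[M] _
    rw [map_add]
    filter_upwards [Lp.coeFn_add (T f) (T g), hf, hg] with p h1 h2 h3
    rw [h1, Pi.add_apply, h2, h3, inner_add_right]
  smul_mem' c f hf := by
    change T (c • f) =ᵐ[M] _
    rw [map_smul]
    filter_upwards [Lp.coeFn_smul c (T f), hf] with p h1 h2
    rw [h1, Pi.smul_apply, h2, inner_smul_right, smul_eq_mul]

/-- An `L²` limit is an almost everywhere limit along a subsequence, while the inner products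
converge everywhere. -/
theorem isClosed_evalSubmodule {Ω : Type*} [MeasurableSpace Ω] {M : Measure Ω}
    (T : H →L[ℂ] Lp ℂ 2 M) (h : Ω → H) : IsClosed (evalSubmodule T h : Set H) := by
  refine isSeqClosed_iff_isClosed.1 fun f g hf hfg => ?_
  have hT : Filter.Tendsto (fun n => T (f n)) Filter.atTop (nhds (T g)) :=
    (T.continuous.tendsto g).comp hfg
  obtain ⟨ns, hns, hae⟩ := (tendstoInMeasure_of_tendsto_Lp hT).exists_seq_tendsto_ae
  have hall : ∀ᵐ p ∂M, ∀ n, T (f n) p = ⟪h p, f n⟫_ℂ := ae_all_iff.2 hf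
  change T g =ᵐ[M] _
  filter_upwards [hae, hall] with p h1 h2
  refine tendsto_nhds_unique h1 ?_
  simp only [h2]
  have : Filter.Tendsto (fun n => ⟪h p, f n⟫_ℂ) Filter.atTop (nhds ⟪h p, g⟫_ℂ) :=
    Filter.Tendsto.inner tendsto_const_nhds hfg
  exact this.comp hns.tendsto_atTop

end HilbertSpace

section Characters

open scoped InnerProductSpace ComplexConjugate
open BoundedContinuousFunction (probCharDual probCharDual_apply)

variable {E : Type*} [NormedAddCommGroup E] [NormedSpace ℝ E]

lemma norm_probCharDual (L : StrongDual ℝ E) (x : E) : ‖probCharDual L x‖ = 1 := by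
  rw [probCharDual_apply, Complex.norm_exp_ofReal_mul_I]

lemma probCharDual_neg_apply (L : StrongDual ℝ E) (x : E) :
    probCharDual (-L) x = conj (probCharDual L x) := by
  simp [probCharDual_apply, ← Complex.exp_conj]

variable [MeasurableSpace E] [BorelSpace E]

lemma memLp_probCharDual (μ : Measure E) [IsFiniteMeasure μ] (L : StrongDual ℝ E) :
    MemLp (probCharDual L) 2 μ :=
  MemLp.of_bound (probCharDual L).continuous.aestronglyMeasurable 1
    (Filter.Eventually.of_forall fun x => (norm_probCharDual L x).le)

/-- The character `x ↦ exp (i L x)` as an element of `L²`. -/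
def charLp (μ : Measure E) [IsFiniteMeasure μ] (L : StrongDual ℝ E) : Lp ℂ 2 μ :=
  (memLp_probCharDual μ L).toLp _

lemma coeFn_charLp (μ : Measure E) [IsFiniteMeasure μ] (L : StrongDual ℝ E) :
    charLp μ L =ᵐ[μ] probCharDual L := (memLp_probCharDual μ L).coeFn_toLp

variable [SecondCountableTopology E] [CompleteSpace E]

lemma ae_eq_zero_of_integral_probCharDual_real {μ : Measure E} [IsFiniteMeasure μ] {g : E → ℝ}
    (hg : Integrable g μ) (h : ∀ L : StrongDual ℝ E, ∫ x, probCharDual L x * g x ∂μ = 0) :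
    g =ᵐ[μ] 0 := by
  have hm : AEMeasurable (fun x => ENNReal.ofReal (g x)) μ := hg.aemeasurable.ennreal_ofReal
  have hm' : AEMeasurable (fun x => ENNReal.ofReal (-g x)) μ :=
    hg.aemeasurable.neg.ennreal_ofReal
  have : IsFiniteMeasure (μ.withDensity fun x => ENNReal.ofReal (g x)) :=
    isFiniteMeasure_withDensity_ofReal hg.2
  have : IsFiniteMeasure (μ.withDensity fun x => ENNReal.ofReal (-g x)) :=
    isFiniteMeasure_withDensity_ofReal hg.neg.2
  have key : (μ.withDensity fun x => ENNReal.ofReal (g x)) =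
      μ.withDensity fun x => ENNReal.ofReal (-g x) := by
    refine Measure.ext_of_charFunDual (funext fun L => ?_)
    have hb : ∀ r : E → ℝ, Integrable r μ → Integrable (fun x => r x • probCharDual L x) μ := by
      intro r hr
      have h1 : Integrable (fun x => probCharDual L x * (r x : ℂ)) μ :=
        hr.ofReal.bdd_mul (probCharDual L).continuous.aestronglyMeasurable
          (Filter.Eventually.of_forall fun x => (norm_probCharDual L x).le)
      refine h1.congr (Filter.Eventually.of_forall fun x => ?_)
      simp only [Complex.real_smul, mul_comm]
    rw [charFunDual, charFunDual,
      integral_withDensity_eq_integral_toReal_smul₀ hm (by simp),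
      integral_withDensity_eq_integral_toReal_smul₀ hm' (by simp), ← sub_eq_zero,
      ← integral_sub, ← h L]
    · refine integral_congr_ae (Filter.Eventually.of_forall fun x => ?_)
      simp only [ENNReal.toReal_ofReal', ← sub_smul, max_zero_sub_eq_self]
      rw [Complex.real_smul, mul_comm]
    · exact hb _ (by simpa only [ENNReal.toReal_ofReal'] using hg.pos_part)
    · exact hb _ (by simpa only [ENNReal.toReal_ofReal'] using hg.neg_part)
  have h2 := (withDensity_eq_iff hm hm' hg.lintegral_lt_top.ne).1 key
  filter_upwards [h2] with x hx
  have h3 : max (g x) 0 = max (-g x) 0 := by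
    simpa [ENNReal.toReal_ofReal'] using congrArg ENNReal.toReal hx
  rcases le_total 0 (g x) with h | h
  · simpa [h] using h3
  · simpa [h, eq_comm] using h3

lemma ae_eq_zero_of_integral_probCharDual {μ : Measure E} [IsFiniteMeasure μ] {G : E → ℂ}
    (hG : Integrable G μ) (h : ∀ L : StrongDual ℝ E, ∫ x, probCharDual L x * G x ∂μ = 0) :
    G =ᵐ[μ] 0 := by
  have hint : ∀ (F : E → ℂ), Integrable F μ → ∀ L : StrongDual ℝ E,
      Integrable (fun x => probCharDual L x * F x) μ := fun F hF L =>
    hF.bdd_mul (probCharDual L).continuous.aestronglyMeasurable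
      (Filter.Eventually.of_forall fun x => (norm_probCharDual L x).le)
  have hre : ∀ F : E → ℂ, Integrable F μ →
      (∀ L : StrongDual ℝ E, ∫ x, probCharDual L x * F x ∂μ = 0) →
      (fun x => (F x).re) =ᵐ[μ] 0 := by
    intro F hF hF0
    refine ae_eq_zero_of_integral_probCharDual_real hF.re fun L => ?_
    have h1 := hF0 L
    have h2 : ∫ x, conj (probCharDual (-L) x * F x) ∂μ = 0 := by
      rw [integral_conj, hF0 (-L), map_zero]
    have hc : Integrable (fun x => conj (probCharDual (-L) x * F x)) μ :=
      Complex.conjLIE.integrable_comp_iff.2 (hint F hF (-L))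
    have h3 : ∫ x, (2 : ℂ) * (probCharDual L x * ((F x).re : ℂ)) ∂μ = 0 := by
      rw [← add_zero (0 : ℂ)]
      nth_rewrite 1 [← h1]
      rw [← h2, ← integral_add (hint F hF L) hc]
      refine integral_congr_ae (Filter.Eventually.of_forall fun x => ?_)
      simp only [probCharDual_neg_apply, map_mul, Complex.conj_conj]
      rw [← mul_add, Complex.add_conj]
      push_cast
      ring
    rw [integral_const_mul] at h3
    simpa using h3
  have h1 := hre G hG h
  have h2 := hre (fun x => -Complex.I * G x) (hG.const_mul _) fun L => by
    have : ∀ x, probCharDual L x * (-Complex.I * G x) = -Complex.I * (probCharDual L x * G x) :=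
      fun x => by ring
    simp only [this]
    rw [integral_const_mul, h L, mul_zero]
  filter_upwards [h1, h2] with x hx1 hx2
  apply Complex.ext
  · simpa using hx1
  · simpa using hx2

/-- A finite measure with integrable complex density is determined by its Fourier transform, so
that the characters are total in `L²`. -/
theorem topologicalClosure_span_charLp (μ : Measure E) [IsFiniteMeasure μ] :
    (Submodule.span ℂ (range (charLp μ))).topologicalClosure = ⊤ := by
  rw [Submodule.topologicalClosure_eq_top_iff, Submodule.eq_bot_iff]
  intro G hG
  have hGi : Integrable G μ := (Lp.memLp G).integrable (by norm_num)
  have h0 : ∀ L : StrongDual ℝ E, ∫ x, probCharDual L x * G x ∂μ = 0 := by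
    intro L
    have h1 := (Submodule.mem_orthogonal _ _).1 hG (charLp μ (-L))
      (Submodule.subset_span ⟨-L, rfl⟩)
    rw [L2.inner_def] at h1
    rw [← h1]
    refine integral_congr_ae ?_
    filter_upwards [coeFn_charLp μ (-L)] with x hx
    rw [hx, RCLike.inner_apply, probCharDual_neg_apply, Complex.conj_conj, mul_comm]
  refine Lp.ext ?_
  exact (ae_eq_zero_of_integral_probCharDual hGi h0).trans (Lp.coeFn_zero ℂ 2 μ).symm

end Characters

/-! ### Gaussian integrals and the finite-dimensional transform -/

section GaussianIntegrals

open scoped InnerProductSpace ComplexConjugate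
open BoundedContinuousFunction (probCharDual probCharDual_apply)

variable {d : ℕ}

/-- The function `x ↦ exp (γ ∑ x_k² + ∑ l_k x_k)` on `ℝ^d`. -/
def quadExp (γ : ℝ) (l : Fin d → ℂ) (x : Fin d → ℝ) : ℂ :=
  Complex.exp (γ * ∑ k, (x k : ℂ) ^ 2 + ∑ k, l k * x k)

@[fun_prop]
lemma continuous_quadExp (γ : ℝ) (l : Fin d → ℂ) : Continuous (quadExp γ l) := by
  unfold quadExp
  fun_prop

lemma quadExp_mul (γ γ' : ℝ) (l l' : Fin d → ℂ) (x : Fin d → ℝ) :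
    quadExp γ l x * quadExp γ' l' x = quadExp (γ + γ') (l + l') x := by
  simp only [quadExp, ← Complex.exp_add, Pi.add_apply, add_mul, Finset.sum_add_distrib]
  push_cast
  ring_nf

lemma conj_quadExp (γ : ℝ) (l : Fin d → ℂ) (x : Fin d → ℝ) :
    conj (quadExp γ l x) = quadExp γ (fun k => conj (l k)) x := by
  simp [quadExp, ← Complex.exp_conj]

lemma integrable_quadExp {γ : ℝ} (hγ : γ < 0) (l : Fin d → ℂ) : Integrable (quadExp γ l) := by
  have h := GaussianFourier.integrable_cexp_neg_mul_sum_add (ι := Fin d) (b := -γ)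
    (by simpa using hγ) l
  simpa [quadExp] using! h

/-- The heat kernel is a quadratic exponential in its real argument. -/
lemma heatKernel_sub (t : ℝ) (z : Fin d → ℂ) (x : Fin d → ℝ) :
    heatKernel t (fun k => z k - x k) =
      heatKernel t z * quadExp (-(1 / (2 * t))) (fun k => z k / t) x := by
  simp only [heatKernel, quadExp, mul_assoc, ← Complex.exp_add]
  congr 2
  rcases eq_or_ne t 0 with rfl | ht
  · simp
  have ht' : (t : ℂ) ≠ 0 := by exact_mod_cast ht
  push_cast
  rw [← Finset.sum_neg_distrib, Finset.sum_div, ← Finset.sum_neg_distrib, Finset.sum_div,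
    Finset.mul_sum, ← Finset.sum_add_distrib, ← Finset.sum_add_distrib]
  refine Finset.sum_congr rfl fun k _ => ?_
  field_simp
  ring

/-- The transform of a quadratic exponential, written so that the exponent of the heat kernel
combines with it to `-β x²`. -/
theorem segalBargmann_quadExp (t : ℝ) {β : ℝ} (hβ : 0 < β) (l : Fin d → ℂ) (z : Fin d → ℂ) :
    segalBargmann t (quadExp (1 / (2 * t) - β) l) z =
      heatKernel t z * ((Real.pi / β : ℂ) ^ ((Fintype.card (Fin d) : ℂ) / 2) *
        Complex.exp ((∑ k, (z k / t + l k) ^ 2) / (4 * β))) := by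
  have h := GaussianFourier.integral_cexp_neg_mul_sum_add (ι := Fin d) (b := (β : ℂ))
    (by simpa using hβ) (fun k => z k / t + l k)
  rw [← h, ← integral_const_mul, segalBargmann]
  refine integral_congr_ae (Filter.Eventually.of_forall fun x => ?_)
  simp only [heatKernel_sub, mul_assoc, quadExp_mul]
  congr 1
  simp only [quadExp, Pi.add_apply]
  congr 2
  push_cast
  ring

lemma gaussian_normalization {t : ℝ} (ht : 0 < t) :
    (((2 * Real.pi * t) ^ (-(d : ℝ) / 2) : ℝ) : ℂ) *
      (Real.pi / ((1 / (2 * t) : ℝ) : ℂ)) ^ ((Fintype.card (Fin d) : ℂ) / 2) = 1 := by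
  have h1 : (Real.pi / ((1 / (2 * t) : ℝ) : ℂ)) = ((2 * Real.pi * t : ℝ) : ℂ) := by
    push_cast
    have : (t : ℂ) ≠ 0 := by exact_mod_cast ht.ne'
    field_simp
  have hp : 0 < 2 * Real.pi * t := by positivity
  rw [h1, Fintype.card_fin, show ((d : ℂ) / 2) = (((d : ℝ) / 2 : ℝ) : ℂ) by push_cast; ring,
    ← Complex.ofReal_cpow hp.le, ← Complex.ofReal_mul, ← Real.rpow_add hp]
  simp [neg_div]

/-- The transform multiplies the exponential with frequency `l` by `exp (t l² / 2)`. -/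
theorem segalBargmann_exp {t : ℝ} (ht : 0 < t) (l : Fin d → ℂ) (z : Fin d → ℂ) :
    segalBargmann t (quadExp 0 l) z =
      Complex.exp (∑ k, l k * z k + t / 2 * ∑ k, l k ^ 2) := by
  have h := segalBargmann_quadExp t (β := 1 / (2 * t)) (by positivity) l z
  rw [sub_self] at h
  rw [h, heatKernel, mul_mul_mul_comm, gaussian_normalization ht, one_mul, ← Complex.exp_add]
  congr 1
  have ht' : (t : ℂ) ≠ 0 := by exact_mod_cast ht.ne'
  push_cast
  rw [← Finset.sum_neg_distrib, Finset.sum_div, Finset.sum_div, Finset.mul_sum,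
    ← Finset.sum_add_distrib, ← Finset.sum_add_distrib]
  refine Finset.sum_congr rfl fun k _ => ?_
  field_simp
  ring

/-- The density `(2πv)^{-d/2} exp (-x²/2v)` on `ℝ^d`. -/
def gaussDensity (v : ℝ) (x : Fin d → ℝ) : ℝ :=
  (2 * Real.pi * v) ^ (-(d : ℝ) / 2) * Real.exp (-(∑ k, x k ^ 2) / (2 * v))

@[fun_prop]
lemma continuous_gaussDensity (v : ℝ) : Continuous (gaussDensity (d := d) v) := by
  unfold gaussDensity
  fun_prop

lemma gaussDensity_pos {v : ℝ} (hv : 0 < v) (x : Fin d → ℝ) : 0 < gaussDensity v x :=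
  mul_pos (Real.rpow_pos_of_pos (by positivity) _) (Real.exp_pos _)

lemma ofReal_gaussDensity (v : ℝ) (x : Fin d → ℝ) :
    (gaussDensity v x : ℂ) =
      (((2 * Real.pi * v) ^ (-(d : ℝ) / 2) : ℝ) : ℂ) * quadExp (-(1 / (2 * v))) 0 x := by
  simp only [gaussDensity, quadExp, Complex.ofReal_mul]
  congr 1
  push_cast
  congr 1
  simp
  ring

lemma heatKernel_zero_sub (v : ℝ) (x : Fin d → ℝ) :
    heatKernel v (fun k => (0 : Fin d → ℂ) k - x k) = gaussDensity v x := by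
  rw [heatKernel_sub, ofReal_gaussDensity]
  congr 1
  · simp [heatKernel]
  · congr 1
    ext k
    simp

variable (d) in
/-- The centred Gaussian measure on `ℝ^d` with covariance `v` times the identity. -/
def gaussMeasure (v : ℝ) : Measure (Fin d → ℝ) :=
  volume.withDensity fun x => ENNReal.ofReal (gaussDensity v x)

lemma integral_gaussMeasure {v : ℝ} (hv : 0 < v) (f : (Fin d → ℝ) → ℂ) :
    ∫ x, f x ∂gaussMeasure d v = ∫ x, gaussDensity v x * f x := by
  rw [gaussMeasure, integral_withDensity_eq_integral_toReal_smul (by fun_prop) (by simp)]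
  refine integral_congr_ae (Filter.Eventually.of_forall fun x => ?_)
  simp [ENNReal.toReal_ofReal (gaussDensity_pos hv x).le]

lemma integrable_gaussMeasure_iff {v : ℝ} (hv : 0 < v) (f : (Fin d → ℝ) → ℂ) :
    Integrable f (gaussMeasure d v) ↔ Integrable fun x => (gaussDensity v x : ℂ) * f x := by
  rw [gaussMeasure, integrable_withDensity_iff_integrable_smul' (by fun_prop) (by simp)]
  refine integrable_congr (Filter.Eventually.of_forall fun x => ?_)
  simp [ENNReal.toReal_ofReal (gaussDensity_pos hv x).le]

lemma isProbabilityMeasure_gaussMeasure {v : ℝ} (hv : 0 < v) :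
    IsProbabilityMeasure (gaussMeasure d v) := by
  have hC : Integrable fun x : Fin d → ℝ => (gaussDensity v x : ℂ) := by
    simp only [ofReal_gaussDensity]
    exact (integrable_quadExp (by simpa using hv) _).const_mul _
  have hi : Integrable (gaussDensity (d := d) v) := by simpa using hC.re
  have h := segalBargmann_exp hv 0 (0 : Fin d → ℂ)
  rw [segalBargmann] at h
  simp only [heatKernel_zero_sub] at h
  have h1 : ∫ x : Fin d → ℝ, gaussDensity v x = 1 := by
    rw [← Complex.ofReal_inj, ← integral_complex_ofReal]
    simpa [quadExp] using h
  refine ⟨?_⟩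
  rw [gaussMeasure, withDensity_apply _ MeasurableSet.univ, Measure.restrict_univ,
    ← ofReal_integral_eq_lintegral_ofReal hi
      (Filter.Eventually.of_forall fun x => (gaussDensity_pos hv x).le), h1, ENNReal.ofReal_one]

theorem charFunDual_gaussMeasure {v : ℝ} (hv : 0 < v) (L : StrongDual ℝ (Fin d → ℝ)) :
    charFunDual (gaussMeasure d v) L =
      Complex.exp (-(v / 2) * ∑ k, (L (Pi.single k 1) : ℂ) ^ 2) := by
  have h := segalBargmann_exp hv (fun k => Complex.I * (L (Pi.single k 1) : ℂ)) (0 : Fin d → ℂ)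
  have hL : ∀ x, L x = ∑ k, L (Pi.single k 1) * x k := by
    intro x
    conv_lhs => rw [pi_eq_sum_univ' x, map_sum]
    simp [mul_comm]
  rw [charFunDual, integral_gaussMeasure hv]
  rw [segalBargmann] at h
  simp only [heatKernel_zero_sub] at h
  convert h using 2
  · ext x
    rw [probCharDual_apply, quadExp, hL]
    congr 2
    simp [Finset.sum_mul]
    refine Finset.sum_congr rfl fun k _ => by ring
  · simp [mul_pow, Finset.mul_sum]

lemma memLp_quadExp {v γ : ℝ} (hv : 0 < v) (hγ : γ < 1 / (4 * v)) (l : Fin d → ℂ) :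
    MemLp (quadExp γ l) 2 (gaussMeasure d v) := by
  rw [memLp_two_iff_integrable_sq_norm (by fun_prop)]
  have h1 : Integrable (quadExp (γ + γ) ((fun k => conj (l k)) + l)) (gaussMeasure d v) := by
    rw [integrable_gaussMeasure_iff hv]
    simp only [ofReal_gaussDensity, mul_assoc, quadExp_mul]
    refine (integrable_quadExp ?_ _).const_mul _
    have : 1 / (4 * v) = 1 / (2 * v) / 2 := by field_simp; norm_num
    linarith
  refine h1.re.congr (Filter.Eventually.of_forall fun x => ?_)
  simp only [← quadExp_mul, ← conj_quadExp, Complex.conj_mul']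
  norm_cast

/-- The kernel representing the transform at `z` in `L²` of the Gaussian measure of variance `s`.
The conjugate is there because the inner product is conjugate-linear in its first argument. -/
def transformKernel (s t : ℝ) (z : Fin d → ℂ) (x : Fin d → ℝ) : ℂ :=
  conj (heatKernel t (fun k => z k - x k) / gaussDensity s x)

/-- The kernel grows like `exp (x² / 2s - x² / 2t)`, which is square-integrable exactly because
`t / 2 < s`. -/
theorem memLp_transformKernel {s t : ℝ} (ht : 0 < t) (hst : t / 2 < s) (z : Fin d → ℂ) :
    MemLp (transformKernel s t z) 2 (gaussMeasure d s) := by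
  have hs : 0 < s := by linarith
  have h1 : transformKernel s t z = fun x =>
      conj (heatKernel t z / (((2 * Real.pi * s) ^ (-(d : ℝ) / 2) : ℝ) : ℂ)) *
        quadExp (1 / (2 * s) - 1 / (2 * t)) (fun k => conj (z k / t)) x := by
    ext x
    rw [transformKernel, heatKernel_sub, ofReal_gaussDensity, ← conj_quadExp, ← map_mul]
    congr 1
    have hq : quadExp (-(1 / (2 * s))) 0 x ≠ 0 := Complex.exp_ne_zero _
    have hm := quadExp_mul (1 / (2 * s) - 1 / (2 * t)) (-(1 / (2 * s))) (fun k => z k / t) 0 x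
    rw [show 1 / (2 * s) - 1 / (2 * t) + -(1 / (2 * s)) = -(1 / (2 * t)) by ring, add_zero] at hm
    rw [← hm]
    field_simp
  rw [h1]
  refine (memLp_quadExp hs ?_ _).const_mul _
  rw [sub_lt_iff_lt_add]
  have h2 : 1 / (2 * s) = 1 / (4 * s) + 1 / (4 * s) := by field_simp; norm_num
  have h3 : 1 / (4 * s) < 1 / (2 * t) := one_div_lt_one_div_of_lt (by linarith) (by linarith)
  linarith

theorem segalBargmann_eq_integral {s t : ℝ} (hs : 0 < s) (φ : (Fin d → ℝ) → ℂ) (z : Fin d → ℂ) :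
    segalBargmann t φ z = ∫ x, conj (transformKernel s t z x) * φ x ∂gaussMeasure d s := by
  rw [integral_gaussMeasure hs, segalBargmann]
  refine integral_congr_ae (Filter.Eventually.of_forall fun x => ?_)
  have : (gaussDensity s x : ℂ) ≠ 0 := by exact_mod_cast (gaussDensity_pos hs x).ne'
  simp only [transformKernel, Complex.conj_conj]
  field_simp

end GaussianIntegrals

/-! ### The reproducing kernel of the finite-dimensional holomorphic space -/

section Reproducing

open scoped InnerProductSpace ComplexConjugate

variable {d : ℕ}

lemma measurePreserving_rotate (θ : ℝ) :
    MeasurePreserving (fun (u : Fin d → ℂ) k => Complex.exp (θ * Complex.I) * u k) := by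
  have h := volume_preserving_pi (ι := Fin d) (α' := fun _ => ℂ) (β' := fun _ => ℂ)
    (f := fun _ => rotation (Circle.exp θ))
    (fun _ => (rotation (Circle.exp θ)).measurePreserving)
  convert! h using 2

/-- An entire function averages to its value at the origin against every rotation-invariant
weight, since it does so on each circle `θ ↦ e^{iθ} u`. -/
theorem integral_mul_eq_of_rotation_invariant {F : (Fin d → ℂ) → ℂ} (hF : Differentiable ℂ F)
    {ρ : (Fin d → ℂ) → ℂ} (hρ : Continuous ρ)
    (hrot : ∀ (θ : ℝ) u, ρ (fun k => Complex.exp (θ * Complex.I) * u k) = ρ u)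
    (hi : Integrable fun u => F u * ρ u) : ∫ u, F u * ρ u = F 0 * ∫ u, ρ u := by
  set R : ℝ → (Fin d → ℂ) → (Fin d → ℂ) := fun θ u k => Complex.exp (θ * Complex.I) * u k with hR
  set g : (Fin d → ℂ) → ℂ := fun u => F u * ρ u with hg
  have hgc : Continuous g := hF.continuous.mul hρ
  have hRc : Continuous fun q : ℝ × (Fin d → ℂ) => R q.1 q.2 := by
    simp only [hR]
    fun_prop
  have hemb : ∀ θ, MeasurableEmbedding (R θ) := by
    intro θ
    have hc : Continuous (R θ) := hRc.comp (by fun_prop : Continuous fun u => (θ, u))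
    refine hc.measurableEmbedding fun u v huv => ?_
    ext k
    exact mul_left_cancel₀ (Complex.exp_ne_zero _) (congrFun huv k)
  set τ : Measure ℝ := volume.restrict (Ioc 0 (2 * Real.pi)) with hτ
  have hprod : Integrable (Function.uncurry fun θ u => g (R θ u)) (τ.prod volume) := by
    rw [integrable_prod_iff (f := Function.uncurry fun θ u => g (R θ u))
      (hgc.comp hRc).aestronglyMeasurable]
    refine ⟨Filter.Eventually.of_forall fun θ => ?_, ?_⟩
    · exact ((measurePreserving_rotate θ).integrable_comp_emb (hemb θ)).2 hi
    · have : (fun θ => ∫ u, ‖g (R θ u)‖) = fun _ => ∫ u, ‖g u‖ := by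
        ext θ
        exact (measurePreserving_rotate θ).integral_comp (hemb θ) (fun u => ‖g u‖)
      simp only [Function.uncurry, this]
      exact integrable_const _
  have hswap := integral_integral_swap hprod
  have hleft : ∀ θ, ∫ u, g (R θ u) = ∫ u, g u := fun θ =>
    (measurePreserving_rotate θ).integral_comp (hemb θ) g
  have hmean : ∀ u, ∫ θ, g (R θ u) ∂τ = (2 * Real.pi) • (F 0 * ρ u) := by
    intro u
    have hf : Differentiable ℂ fun ζ : ℂ => F (fun k => ζ * u k) := by
      refine hF.comp ?_
      rw [differentiable_pi]
      intro k
      fun_prop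
    have h1 := (hf.diffContOnCl (s := Metric.ball 0 |1|)).circleAverage
    rw [Real.circleAverage_def, inv_smul_eq_iff₀ (by positivity),
      intervalIntegral.integral_of_le (by positivity)] at h1
    simp only [hg, hR, hrot]
    rw [integral_mul_const]
    simp only [circleMap_zero, Complex.ofReal_one, one_mul, zero_mul] at h1
    rw [h1]
    simp [mul_assoc]
    left; rfl
  simp only [hleft, hmean] at hswap
  rw [integral_const, integral_smul, integral_const_mul] at hswap
  have hvol : τ.real univ = 2 * Real.pi := by
    simp [hτ, Measure.real, Real.pi_pos.le]
  rw [hvol] at hswap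
  exact smul_right_injective ℂ (by positivity : (2 * Real.pi) ≠ 0) hswap

/-- The reproducing formula of the Segal–Bargmann space: translation by `w` turns it into the
mean value property of `u ↦ Ψ (w + u) exp (-κ ⟨w, u⟩)` with respect to a Gaussian weight. -/
theorem integral_mul_reproducing {Ψ : (Fin d → ℂ) → ℂ} (hΨ : Differentiable ℂ Ψ) (κ : ℝ)
    (w : Fin d → ℂ)
    (hi : Integrable fun z =>
      Ψ z * Complex.exp (κ * ∑ k, conj (z k) * w k - κ * ∑ k, conj (z k) * z k)) :
    ∫ z, Ψ z * Complex.exp (κ * ∑ k, conj (z k) * w k - κ * ∑ k, conj (z k) * z k) =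
      Ψ w * ∫ u : Fin d → ℂ, Complex.exp (-κ * ∑ k, conj (u k) * u k) := by
  set F : (Fin d → ℂ) → ℂ := fun u => Ψ (w + u) * Complex.exp (-κ * ∑ k, conj (w k) * u k)
  have hF : Differentiable ℂ F := by
    refine (hΨ.comp (differentiable_id.const_add w)).mul ?_
    fun_prop
  have hρ : Continuous fun u : Fin d → ℂ => Complex.exp (-κ * ∑ k, conj (u k) * u k) := by
    fun_prop
  have heq : ∀ u, Ψ (w + u) * Complex.exp (κ * ∑ k, conj ((w + u) k) * w k -
      κ * ∑ k, conj ((w + u) k) * (w + u) k) =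
      F u * Complex.exp (-κ * ∑ k, conj (u k) * u k) := by
    intro u
    simp only [F, mul_assoc, ← Complex.exp_add]
    congr 2
    simp only [Pi.add_apply, map_add, add_mul, mul_add, Finset.sum_add_distrib]
    ring
  have h := integral_mul_eq_of_rotation_invariant hF hρ (fun θ u => ?_) ?_
  · rw [← integral_add_left_eq_self _ w]
    simp only [heq]
    rw [h]
    simp [F]
  · simp only [map_mul, ← Complex.exp_conj]
    congr 2
    refine Finset.sum_congr rfl fun k _ => ?_
    have : Complex.exp (conj (θ : ℂ) * conj Complex.I) * Complex.exp ((θ : ℂ) * Complex.I) = 1 := by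
      rw [← Complex.exp_add]
      simp
    linear_combination (conj (u k) * u k) * this
  · simp only [← heq]
    exact hi.comp_add_left w

lemma integral_exp_neg_sum_ne_zero {κ : ℝ} (hκ : 0 < κ) :
    ∫ u : Fin d → ℂ, Complex.exp (-κ * ∑ k, conj (u k) * u k) ≠ 0 := by
  have h : ∀ u : Fin d → ℂ, Complex.exp (-κ * ∑ k, conj (u k) * u k) =
      ∏ k, Complex.exp (-κ * ‖u k‖ ^ 2) := by
    intro u
    rw [← Complex.exp_sum, Finset.mul_sum]
    simp only [Complex.conj_mul']
  simp only [h]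
  rw [integral_fintype_prod_volume_eq_prod (fun _ (z : ℂ) => Complex.exp (-κ * ‖z‖ ^ 2))]
  refine Finset.prod_ne_zero_iff.2 fun _ _ => ?_
  rw [GaussianFourier.integral_cexp_neg_mul_sq_norm (by simpa using hκ)]
  rw [Complex.cpow_def_of_ne_zero (by simp [Real.pi_ne_zero, hκ.ne'])]
  exact Complex.exp_ne_zero _

/-- The point `x + iy` of `ℂ^d`. -/
def complexPoint (p : (Fin d → ℝ) × (Fin d → ℝ)) : Fin d → ℂ := fun k => p.1 k + Complex.I * p.2 k

lemma measurePreserving_complexPoint :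
    MeasurePreserving (complexPoint (d := d)) (volume.prod volume) volume := by
  have h1 := (volume_measurePreserving_arrowProdEquivProdArrow ℝ ℝ (Fin d)).symm
  have h2 := volume_preserving_pi (ι := Fin d) (α' := fun _ => ℝ × ℝ) (β' := fun _ => ℂ)
    (f := fun _ => Complex.measurableEquivRealProd.symm)
    (fun _ => Complex.volume_preserving_equiv_real_prod.symm)
  have h := h2.comp h1
  convert! h using 1
  ext p k
  have h3 : complexPoint p k = ⟨p.1 k, p.2 k⟩ := by
    apply Complex.ext <;> simp [complexPoint]
  rw [h3]
  rfl

lemma measurableEmbedding_complexPoint : MeasurableEmbedding (complexPoint (d := d)) := by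
  refine Continuous.measurableEmbedding ?_ ?_
  · unfold complexPoint
    fun_prop
  · intro p q h
    have h' : ∀ k, p.1 k = q.1 k ∧ p.2 k = q.2 k := fun k => by
      have := congrFun h k
      simpa [complexPoint, Complex.ext_iff] using this
    exact Prod.ext (funext fun k => (h' k).1) (funext fun k => (h' k).2)

/-- The Gaussian measure on `ℝ^d × ℝ^d` with variances `a` and `b`. -/
abbrev gaussPair (d : ℕ) (a b : ℝ) : Measure ((Fin d → ℝ) × (Fin d → ℝ)) :=
  (gaussMeasure d a).prod (gaussMeasure d b)

lemma gaussPair_eq_withDensity (a b : ℝ) : gaussPair d a b =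
    (volume.prod volume).withDensity fun p =>
      ENNReal.ofReal (gaussDensity a p.1) * ENNReal.ofReal (gaussDensity b p.2) := by
  rw [gaussPair, gaussMeasure, gaussMeasure, prod_withDensity (by fun_prop) (by fun_prop)]

lemma integral_gaussPair {a b : ℝ} (ha : 0 < a) (hb : 0 < b)
    (f : (Fin d → ℝ) × (Fin d → ℝ) → ℂ) :
    ∫ p, f p ∂gaussPair d a b =
      ∫ p, (gaussDensity a p.1 * gaussDensity b p.2 : ℂ) * f p ∂(volume.prod volume) := by
  rw [gaussPair_eq_withDensity, integral_withDensity_eq_integral_toReal_smul (by fun_prop)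
    (Filter.Eventually.of_forall fun p => ENNReal.mul_lt_top (by simp) (by simp))]
  refine integral_congr_ae (Filter.Eventually.of_forall fun p => ?_)
  simp [ENNReal.toReal_ofReal (gaussDensity_pos ha p.1).le,
    ENNReal.toReal_ofReal (gaussDensity_pos hb p.2).le]

lemma integrable_gaussPair_iff {a b : ℝ} (ha : 0 < a) (hb : 0 < b)
    (f : (Fin d → ℝ) × (Fin d → ℝ) → ℂ) :
    Integrable f (gaussPair d a b) ↔
      Integrable (fun p => (gaussDensity a p.1 * gaussDensity b p.2 : ℂ) * f p)
        (volume.prod volume) := by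
  rw [gaussPair_eq_withDensity, integrable_withDensity_iff_integrable_smul' (by fun_prop)
    (Filter.Eventually.of_forall fun p => ENNReal.mul_lt_top (by simp) (by simp))]
  refine integrable_congr (Filter.Eventually.of_forall fun p => ?_)
  simp [ENNReal.toReal_ofReal (gaussDensity_pos ha p.1).le,
    ENNReal.toReal_ofReal (gaussDensity_pos hb p.2).le]

/-- Up to a factor depending on `w` only, the reproducing kernel at `w` of the space of
holomorphic functions that are square-integrable for the Gaussian measure with variances `a` in
the real and `b` in the imaginary directions. The factor `exp (c z²)` carries the rotation-invariant
Gaussian weight `exp (-κ |z|²)` to that measure, where `c = (1/a - 1/b)/8` and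
`κ = (1/a + 1/b)/4`. -/
def pairKernel (a b : ℝ) (w z : Fin d → ℂ) : ℂ :=
  Complex.exp (((1 / a - 1 / b) / 8 : ℝ) * ∑ k, z k ^ 2 +
    ((1 / a + 1 / b) / 4 : ℝ) * ∑ k, conj (w k) * z k)

lemma differentiable_pairKernel (a b : ℝ) (w : Fin d → ℂ) :
    Differentiable ℂ (pairKernel a b w) := by
  unfold pairKernel
  fun_prop

variable (d) in
/-- The normalization constant of the reproducing formula. -/
def pairConst (a b : ℝ) : ℂ :=
  (((2 * Real.pi * a) ^ (-(d : ℝ) / 2) : ℝ) : ℂ) * (((2 * Real.pi * b) ^ (-(d : ℝ) / 2) : ℝ) : ℂ) *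
    ∫ u : Fin d → ℂ, Complex.exp (-((1 / a + 1 / b) / 4 : ℝ) * ∑ k, conj (u k) * u k)

lemma pairConst_ne_zero {a b : ℝ} (ha : 0 < a) (hb : 0 < b) : pairConst d a b ≠ 0 := by
  refine mul_ne_zero (mul_ne_zero ?_ ?_) (integral_exp_neg_sum_ne_zero (by positivity))
  · exact_mod_cast (Real.rpow_pos_of_pos (by positivity) _).ne'
  · exact_mod_cast (Real.rpow_pos_of_pos (by positivity) _).ne'

/-- The reproducing formula for the Gaussian measure with variances `a` and `b`: its density times
the conjugate kernel is, up to a constant, `exp (-c z²)` times the weight of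
`integral_mul_reproducing`, where `c = (1/a - 1/b)/8`. -/
theorem integral_pairKernel_mul {a b : ℝ} (ha : 0 < a) (hb : 0 < b) {Φ : (Fin d → ℂ) → ℂ}
    (hΦ : Differentiable ℂ Φ) (w : Fin d → ℂ)
    (hi : Integrable (fun p => conj (pairKernel a b w (complexPoint p)) * Φ (complexPoint p))
      (gaussPair d a b)) :
    ∫ p, conj (pairKernel a b w (complexPoint p)) * Φ (complexPoint p) ∂gaussPair d a b =
      pairConst d a b *
        (Φ w * Complex.exp (-((1 / a - 1 / b) / 8 : ℝ) * ∑ k, w k ^ 2)) := by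
  set Ψ : (Fin d → ℂ) → ℂ := fun z =>
    Φ z * Complex.exp (-((1 / a - 1 / b) / 8 : ℝ) * ∑ k, z k ^ 2) with hΨ
  have hΨd : Differentiable ℂ Ψ := by
    refine hΦ.mul ?_
    fun_prop
  set κ : ℝ := (1 / a + 1 / b) / 4 with hκ
  set A : ℂ := (((2 * Real.pi * a) ^ (-(d : ℝ) / 2) : ℝ) : ℂ) *
    (((2 * Real.pi * b) ^ (-(d : ℝ) / 2) : ℝ) : ℂ) with hA
  have hA0 : A ≠ 0 := by
    refine mul_ne_zero ?_ ?_
    · exact_mod_cast (Real.rpow_pos_of_pos (by positivity) _).ne'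
    · exact_mod_cast (Real.rpow_pos_of_pos (by positivity) _).ne'
  set g : (Fin d → ℂ) → ℂ := fun z =>
    Ψ z * Complex.exp (κ * ∑ k, conj (z k) * w k - κ * ∑ k, conj (z k) * z k) with hg
  have heq : ∀ p : (Fin d → ℝ) × (Fin d → ℝ), (gaussDensity a p.1 * gaussDensity b p.2 : ℂ) *
      (conj (pairKernel a b w (complexPoint p)) * Φ (complexPoint p)) =
      A * g (complexPoint p) := by
    intro p
    have hexp : Complex.exp (((-(1 / (2 * a)) : ℝ) : ℂ) * ∑ k, (p.1 k : ℂ) ^ 2 +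
          ∑ k, (0 : Fin d → ℂ) k * p.1 k) *
        Complex.exp (((-(1 / (2 * b)) : ℝ) : ℂ) * ∑ k, (p.2 k : ℂ) ^ 2 +
          ∑ k, (0 : Fin d → ℂ) k * p.2 k) *
        conj (pairKernel a b w (complexPoint p)) =
        Complex.exp (-((1 / a - 1 / b) / 8 : ℝ) * ∑ k, complexPoint p k ^ 2) *
        Complex.exp (κ * ∑ k, conj (complexPoint p k) * w k -
          κ * ∑ k, conj (complexPoint p k) * complexPoint p k) := by
      rw [pairKernel, ← Complex.exp_conj, ← Complex.exp_add, ← Complex.exp_add,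
        ← Complex.exp_add]
      congr 1
      simp only [map_add, map_mul, map_sum, map_pow, Complex.conj_ofReal, Complex.conj_conj,
        Pi.zero_apply, zero_mul, Finset.sum_const_zero, add_zero, Finset.mul_sum]
      simp only [← Finset.sum_add_distrib, ← Finset.sum_sub_distrib]
      refine Finset.sum_congr rfl fun k _ => ?_
      have ha' : (a : ℂ) ≠ 0 := by exact_mod_cast ha.ne'
      have hb' : (b : ℂ) ≠ 0 := by exact_mod_cast hb.ne'
      simp only [complexPoint, hκ, map_add, map_mul, Complex.conj_ofReal, Complex.conj_I]
      push_cast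
      field_simp
      ring_nf
      simp only [Complex.I_sq]
      ring
    rw [ofReal_gaussDensity, ofReal_gaussDensity, quadExp, quadExp]
    simp only [hg, hΨ, hA]
    linear_combination (((2 * Real.pi * a) ^ (-(d : ℝ) / 2) : ℝ) : ℂ) *
      (((2 * Real.pi * b) ^ (-(d : ℝ) / 2) : ℝ) : ℂ) * Φ (complexPoint p) * hexp
  rw [integrable_gaussPair_iff ha hb] at hi
  rw [integral_gaussPair ha hb]
  simp only [heq] at hi ⊢
  rw [integrable_const_mul_iff hA0.isUnit] at hi
  have hgi : Integrable g :=
    (measurePreserving_complexPoint.integrable_comp_emb measurableEmbedding_complexPoint).1 hi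
  rw [integral_const_mul, measurePreserving_complexPoint.integral_comp
    measurableEmbedding_complexPoint, hg, integral_mul_reproducing hΨd κ w hgi, pairConst]
  ring

end Reproducing

/-! ### Gaussian series -/

section GaussianSeries

open BoundedContinuousFunction (probCharDual probCharDual_apply)

variable {E : Type*} [NormedAddCommGroup E] [NormedSpace ℝ E]

/-- A measure whose Fourier transform is `exp (-q/2)` with `q` homogeneous of degree two is
Gaussian. -/
lemma isGaussian_of_charFunDual [MeasurableSpace E] [BorelSpace E] {P : Measure E} [IsFiniteMeasure P]
    {q : StrongDual ℝ E → ℝ}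
    (hq0 : ∀ L, 0 ≤ q L) (hq : ∀ (u : ℝ) L, q (u • L) = u ^ 2 * q L)
    (hP : ∀ L, charFunDual P L = Complex.exp (-(q L / 2))) : IsGaussian P := by
  refine isGaussian_of_map_eq_gaussianReal fun L => ⟨0, (q L).toNNReal, ?_⟩
  refine Measure.ext_of_charFun (funext fun u => ?_)
  rw [charFun_map_eq_charFunDual_smul L u, hP, hq, charFun_gaussianReal]
  congr 1
  rw [Real.coe_toNNReal _ (hq0 L)]
  push_cast
  ring

/-- The law of independent standard Gaussian coordinates. -/
def gaussSeq (ι : Type*) : Measure (ι → ℝ) := Measure.infinitePi fun _ => gaussianReal 0 1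

instance (ι : Type*) : IsProbabilityMeasure (gaussSeq ι) := by
  unfold gaussSeq
  infer_instance

variable {ι : Type*}

lemma measurePreserving_eval_gaussSeq (j : ι) :
    MeasurePreserving (fun p : ι → ℝ => p j) (gaussSeq ι) (gaussianReal 0 1) :=
  measurePreserving_eval_infinitePi (fun _ => gaussianReal 0 1) j

lemma integrable_coord_pow (j : ι) (n : ℕ) :
    Integrable (fun p : ι → ℝ => p j ^ n) (gaussSeq ι) := by
  have h : Integrable (fun x : ℝ => x ^ n) (gaussianReal 0 1) := by
    have h1 := (memLp_id_gaussianReal (μ := 0) (v := 1) n).integrable_norm_pow'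
    refine (integrable_norm_iff (by fun_prop)).1
      (h1.congr (Filter.Eventually.of_forall fun x => ?_))
    simp
  exact (measurePreserving_eval_gaussSeq j).integrable_comp_of_integrable h

lemma integral_coord_pow (j : ι) (n : ℕ) :
    ∫ p, p j ^ n ∂gaussSeq ι = ∫ x, x ^ n ∂gaussianReal 0 1 := by
  have h := (measurePreserving_eval_gaussSeq j)
  rw [← h.map_eq, integral_map h.measurable.aemeasurable (by fun_prop)]

/-- The partial sum over `F` of the series with independent standard Gaussian coefficients. -/
def gaussSum (x : ι → E) (F : Finset ι) (p : ι → ℝ) : E := ∑ j ∈ F, p j • x j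

lemma integral_probCharDual_gaussSum (x : ι → E) (F : Finset ι) (L : StrongDual ℝ E) :
    ∫ p, probCharDual L (gaussSum x F p) ∂gaussSeq ι =
      Complex.exp (-(1 / 2) * ∑ j ∈ F, (L (x j) : ℂ) ^ 2) := by
  have h := integral_restrict_infinitePi (μ := fun _ : ι => gaussianReal 0 1) (s := F)
    (f := fun y => ∏ j : F, Complex.exp (L (x j) * y j * Complex.I))
    (Continuous.aestronglyMeasurable (by fun_prop))
  rw [integral_fintype_prod_eq_prod (fun (j : F) (y : ℝ) =>
    Complex.exp (L (x j) * y * Complex.I))] at h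
  have h1 : ∀ j : F, ∫ y : ℝ, Complex.exp (L (x j) * y * Complex.I) ∂gaussianReal 0 1 =
      Complex.exp (-(1 / 2) * (L (x j) : ℂ) ^ 2) := by
    intro j
    rw [← charFun_apply_real, charFun_gaussianReal]
    congr 1
    simp
    ring
  simp only [h1] at h
  rw [← Complex.exp_sum, ← Finset.mul_sum, Finset.sum_coe_sort F (fun j => (L (x j) : ℂ) ^ 2)] at h
  rw [← h, gaussSeq]
  refine integral_congr_ae (Filter.Eventually.of_forall fun p => ?_)
  simp only [probCharDual_apply, gaussSum, map_sum, map_smul, smul_eq_mul, Finset.restrict]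
  rw [← Complex.exp_sum, Finset.sum_coe_sort F (fun j => (L (x j) : ℂ) * p j * Complex.I),
    ← Finset.sum_mul]
  push_cast
  simp only [mul_comm]

lemma integrable_gaussSum (x : ι → E) (F : Finset ι) :
    Integrable (gaussSum x F) (gaussSeq ι) := by
  unfold gaussSum
  refine integrable_finsetSum _ fun j _ => Integrable.smul_const ?_ _
  simpa using integrable_coord_pow j 1

variable [MeasurableSpace E] [BorelSpace E] [CompleteSpace E]

/-- A Gaussian series whose partial sums along `F n` are Cauchy in mean at a geometric rate
converges, and the Fourier transform of the law of its sum is the limit of those of the partial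
sums. -/
theorem exists_measure_of_gaussSum (x : ι → E) (F : ℕ → Finset ι) {C r : ℝ} (hr : r < 1)
    (hC : ∀ n, ∫ p, ‖gaussSum x (F n) p - gaussSum x (F (n + 1)) p‖ ∂gaussSeq ι ≤ C * r ^ n)
    {q : StrongDual ℝ E → ℝ}
    (hq : ∀ L, Filter.Tendsto (fun n => ∑ j ∈ F n, L (x j) ^ 2) Filter.atTop (nhds (q L))) :
    ∃ P : Measure E, IsProbabilityMeasure P ∧
      ∀ L, charFunDual P L = Complex.exp (-(q L / 2)) := by
  set u : ℕ → Lp E 1 (gaussSeq ι) := fun n => (integrable_gaussSum x (F n)).toL1 _ with hu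
  have hcs : CauchySeq u := by
    refine cauchySeq_of_le_geometric r C hr fun n => ?_
    rw [L1.dist_eq_integral_dist]
    refine le_trans (le_of_eq (integral_congr_ae ?_)) (hC n)
    filter_upwards [(integrable_gaussSum x (F n)).coeFn_toL1,
      (integrable_gaussSum x (F (n + 1))).coeFn_toL1] with p h1 h2
    simp only [hu]
    rw [h1, h2, dist_eq_norm]
  obtain ⟨f, hf⟩ := cauchySeq_tendsto_of_complete hcs
  obtain ⟨ns, hns, hae⟩ := (tendstoInMeasure_of_tendsto_Lp hf).exists_seq_tendsto_ae
  have hfm : AEMeasurable f (gaussSeq ι) := (Lp.aestronglyMeasurable f).aemeasurable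
  refine ⟨(gaussSeq ι).map f, Measure.isProbabilityMeasure_map hfm, fun L => ?_⟩
  rw [charFunDual, integral_map hfm (probCharDual L).continuous.aestronglyMeasurable]
  have hlim : Filter.Tendsto (fun n => ∫ p, probCharDual L (u (ns n) p) ∂gaussSeq ι)
      Filter.atTop (nhds (∫ p, probCharDual L (f p) ∂gaussSeq ι)) := by
    refine tendsto_integral_of_dominated_convergence (fun _ => 1) (fun n => ?_)
      (integrable_const 1) (fun n => Filter.Eventually.of_forall fun p =>
        (norm_probCharDual L _).le) ?_
    · exact (probCharDual L).continuous.comp_aestronglyMeasurable (Lp.aestronglyMeasurable _)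
    · filter_upwards [hae] with p hp
      exact ((probCharDual L).continuous.tendsto _).comp hp
  have hval : ∀ n, ∫ p, probCharDual L (u n p) ∂gaussSeq ι =
      Complex.exp (-(1 / 2) * ∑ j ∈ F n, (L (x j) : ℂ) ^ 2) := by
    intro n
    rw [← integral_probCharDual_gaussSum]
    refine integral_congr_ae ?_
    filter_upwards [(integrable_gaussSum x (F n)).coeFn_toL1] with p hp
    simp only [hu]
    rw [hp]
  simp only [hval] at hlim
  refine tendsto_nhds_unique hlim ?_
  have h2 : Filter.Tendsto (fun n => ((∑ j ∈ F n, L (x j) ^ 2 : ℝ) : ℂ)) Filter.atTop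
      (nhds (q L : ℂ)) := (Complex.continuous_ofReal.tendsto _).comp (hq L)
  have h3 := (Complex.continuous_exp.tendsto _).comp ((h2.comp hns.tendsto_atTop).const_mul
    (-(1 / 2 : ℂ)))
  convert h3 using 2
  · simp
  · ring_nf

end GaussianSeries

/-! ### The path space -/

section PathSpace

open scoped InnerProductSpace

variable {V : Type*} [NormedAddCommGroup V] [InnerProductSpace ℝ V] [FiniteDimensional ℝ V]

lemma isClosed_paths : IsClosed (Paths V : Set C(unitInterval, V)) :=
  isClosed_eq (continuous_eval_const (0 : unitInterval)) continuous_const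

instance : CompleteSpace (Paths V) :=
  have : CompleteSpace V := FiniteDimensional.complete ℝ V
  isClosed_paths.completeSpace_coe

instance : CompleteSpace (Abar V) :=
  (completeSpace_congr (e := (Abar.pathEquiv V).toEquiv)
    (Abar.pathEquiv V).isometry.isUniformEmbedding).1 inferInstance

instance : SecondCountableTopology (Abar V) := by
  have : ProperSpace V := FiniteDimensional.proper ℝ V
  have h : SecondCountableTopology (Paths V) :=
    inferInstanceAs (SecondCountableTopology ((Paths V : Set C(unitInterval, V))))
  exact (Abar.pathEquiv V).toHomeomorph.symm.secondCountableTopology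

/-- The value at `τ` of the path with derivative `A`. -/
def pathValue (τ : unitInterval) : Abar V →ₗ[ℝ] V where
  toFun A := (((Abar.pathEquiv V).symm A : Paths V) : C(unitInterval, V)) τ
  map_add' A B := by simp
  map_smul' c A := by simp

lemma norm_le_of_pathValue_le {A : Abar V} {C : ℝ} (hC : 0 ≤ C)
    (h : ∀ τ, ‖pathValue τ A‖ ≤ C) : ‖A‖ ≤ C := by
  rw [← (Abar.pathEquiv V).symm.norm_map A]
  exact (ContinuousMap.norm_le _ hC).2 h

lemma pathValue_inclL2 (f : ConnL2 V) (τ : unitInterval) :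
    pathValue τ (inclL2 V f) = ∫ σ in (0 : ℝ)..τ, f σ := by
  rw [inclL2_apply, ← primitive_apply]
  simp [pathValue]

lemma integral_Ioc_lebesgue01 {a : ℝ} (h1 : a ≤ 1) (f : ℝ → V) :
    ∫ σ in Ioc 0 a, f σ ∂lebesgue01 = ∫ σ in Ioc 0 a, f σ := by
  have h : Ioc 0 a ⊆ Icc (0 : ℝ) 1 := fun x hx => ⟨hx.1.le, hx.2.trans h1⟩
  rw [lebesgue01, Measure.restrict_restrict measurableSet_Ioc, inter_eq_left.2 h]

/-- A function in `L²` all of whose integrals over `[0, τ]` vanish is zero. -/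
lemma eq_zero_of_pathValue_eq_zero {f : ConnL2 V}
    (h : ∀ τ, pathValue τ (inclL2 V f) = 0) : f = 0 := by
  have : CompleteSpace V := FiniteDimensional.complete ℝ V
  have hi : IntervalIntegrable f volume 0 1 := intervalIntegrable_connL2 f 1
  have hd := hi.ae_hasDerivAt_integral
  refine Lp.ext (Filter.EventuallyEq.trans ?_ (Lp.coeFn_zero V 2 lebesgue01).symm)
  have hae : ∀ᵐ x, x ∈ Icc (0 : ℝ) 1 → f x = 0 := by
    filter_upwards [hd, (Set.countable_singleton (0 : ℝ)).ae_notMem volume,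
      (Set.countable_singleton (1 : ℝ)).ae_notMem volume] with x hx h0 h1 hx01
    rw [uIcc_of_le zero_le_one] at hx
    have hx' : x ∈ Ioo (0 : ℝ) 1 :=
      ⟨lt_of_le_of_ne hx01.1 (Ne.symm h0), lt_of_le_of_ne hx01.2 h1⟩
    have hder := hx hx01 0 (by simp)
    have hz : (fun x => ∫ σ in (0 : ℝ)..x, f σ) =ᶠ[nhds x] fun _ => 0 := by
      filter_upwards [Ioo_mem_nhds hx'.1 hx'.2] with y hy
      rw [← h ⟨y, hy.1.le, hy.2.le⟩, pathValue_inclL2]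
    exact hder.unique ((hasDerivAt_const x (0 : V)).congr_of_eventuallyEq hz)
  exact (ae_restrict_iff' measurableSet_Icc).2 hae

/-- The function `1_{(0,a]} v` in `L²([0,1]; V)`. -/
def stepL2 (a : ℝ) (v : V) : ConnL2 V :=
  indicatorConstLp 2 (measurableSet_Ioc (a := (0 : ℝ)) (b := a)) (measure_ne_top _ _) v

lemma inner_stepL2 {a : ℝ} (ha : a ∈ Icc (0 : ℝ) 1) (v : V) (f : ConnL2 V) :
    ⟪stepL2 a v, f⟫_ℝ = ⟪v, pathValue ⟨a, ha⟩ (inclL2 V f)⟫_ℝ := by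
  have : CompleteSpace V := FiniteDimensional.complete ℝ V
  rw [stepL2, L2.inner_indicatorConstLp_eq_inner_setIntegral, pathValue_inclL2,
    integral_Ioc_lebesgue01 ha.2, intervalIntegral.integral_of_le ha.1]

lemma pathValue_stepL2 {a : ℝ} (ha : a ∈ Icc (0 : ℝ) 1) (v : V) (τ : unitInterval) :
    pathValue τ (inclL2 V (stepL2 a v)) = min a τ • v := by
  have : CompleteSpace V := FiniteDimensional.complete ℝ V
  rw [pathValue_inclL2, intervalIntegral.integral_of_le τ.2.1, ← integral_Ioc_lebesgue01 τ.2.2,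
    stepL2, setIntegral_indicatorConstLp measurableSet_Ioc]
  have h : Ioc (max 0 0) (min (τ : ℝ) a) ⊆ Icc (0 : ℝ) 1 := fun x hx =>
    ⟨(le_max_left _ _).trans hx.1.le, hx.2.trans ((min_le_right _ _).trans ha.2)⟩
  congr 1
  rw [Measure.real, inter_comm, Ioc_inter_Ioc, lebesgue01, Measure.restrict_apply measurableSet_Ioc,
    inter_eq_left.2 h, Real.volume_Ioc, max_self, sub_zero,
    ENNReal.toReal_ofReal (le_min τ.2.1 ha.1), min_comm]

lemma stepL2_zero (v : V) : stepL2 0 v = 0 := by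
  simp [stepL2]

lemma inner_stepL2_stepL2 {a b : ℝ} (ha : a ∈ Icc (0 : ℝ) 1) (hb : b ∈ Icc (0 : ℝ) 1) (v w : V) :
    ⟪stepL2 a v, stepL2 b w⟫_ℝ = min a b * ⟪v, w⟫_ℝ := by
  rw [inner_stepL2 ha, pathValue_stepL2 hb, inner_smul_right, min_comm]

lemma continuous_pathValue (A : Abar V) : Continuous fun τ => pathValue τ A :=
  (((Abar.pathEquiv V).symm A : Paths V) : C(unitInterval, V)).continuous

end PathSpace

/-! ### Dyadic energy and the Haar system -/

section Dyadic

open scoped InnerProductSpace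

/-- The dyadic point `k / 2^N`. -/
def dyadicPt (N k : ℕ) : ℝ := k / 2 ^ N

lemma dyadicPt_succ (N k : ℕ) : dyadicPt (N + 1) (2 * k) = dyadicPt N k := by
  simp only [dyadicPt, pow_succ]
  push_cast
  field_simp

lemma dyadicPt_mem {N k : ℕ} (hk : k ≤ 2 ^ N) : dyadicPt N k ∈ Icc (0 : ℝ) 1 := by
  refine ⟨by unfold dyadicPt; positivity, ?_⟩
  rw [dyadicPt, div_le_one (by positivity)]
  exact_mod_cast hk

lemma dyadicPt_mono {N k l : ℕ} (h : k ≤ l) : dyadicPt N k ≤ dyadicPt N l := by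
  unfold dyadicPt
  gcongr

lemma dyadicPt_succ_sub (N k : ℕ) : dyadicPt N (k + 1) - dyadicPt N k = (2 ^ N)⁻¹ := by
  unfold dyadicPt
  push_cast
  ring

lemma dyadicPt_mid (N k : ℕ) :
    2 * dyadicPt (N + 1) (2 * k + 1) = dyadicPt N k + dyadicPt N (k + 1) := by
  simp only [dyadicPt, pow_succ]
  push_cast
  field_simp
  ring

lemma sum_range_two_mul (f : ℕ → ℝ) (n : ℕ) :
    ∑ k ∈ Finset.range (2 * n), f k = ∑ k ∈ Finset.range n, (f (2 * k) + f (2 * k + 1)) := by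
  induction n with
  | zero => simp
  | succ n ih => rw [mul_add, mul_one, Finset.sum_range_succ, Finset.sum_range_succ, ih,
      Finset.sum_range_succ, add_assoc]

/-- The energy `2^N ∑ (G ((k+1)/2^N) - G (k/2^N))²` of the polygonal interpolation of `G` at the
dyadic points of order `N`. -/
def dyadicEnergy (G : ℝ → ℝ) (N : ℕ) : ℝ :=
  2 ^ N * ∑ k ∈ Finset.range (2 ^ N), (G (dyadicPt N (k + 1)) - G (dyadicPt N k)) ^ 2

/-- By the parallelogram law, refining the dyadic grid adds the squares of the Haar
coefficients. -/
lemma dyadicEnergy_succ (G : ℝ → ℝ) (N : ℕ) :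
    dyadicEnergy G (N + 1) = dyadicEnergy G N + ∑ k ∈ Finset.range (2 ^ N),
      2 ^ N * (2 * G (dyadicPt (N + 1) (2 * k + 1)) - G (dyadicPt N k) -
        G (dyadicPt N (k + 1))) ^ 2 := by
  rw [dyadicEnergy, dyadicEnergy, show (2 : ℕ) ^ (N + 1) = 2 * 2 ^ N from pow_succ' 2 N,
    sum_range_two_mul, Finset.mul_sum, Finset.mul_sum,
    ← Finset.sum_add_distrib]
  have h : (2 : ℝ) ^ (N + 1) = 2 * 2 ^ N := pow_succ' 2 N
  refine Finset.sum_congr rfl fun k _ => ?_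
  rw [show 2 * k + 1 + 1 = 2 * (k + 1) by ring, dyadicPt_succ, dyadicPt_succ]
  ring

lemma dyadicEnergy_eq (G : ℝ → ℝ) (N : ℕ) :
    dyadicEnergy G N = (G 1 - G 0) ^ 2 + ∑ n ∈ Finset.range N, ∑ k ∈ Finset.range (2 ^ n),
      2 ^ n * (2 * G (dyadicPt (n + 1) (2 * k + 1)) - G (dyadicPt n k) -
        G (dyadicPt n (k + 1))) ^ 2 := by
  induction N with
  | zero => simp [dyadicEnergy, dyadicPt]
  | succ N ih => rw [dyadicEnergy_succ, ih, Finset.sum_range_succ, add_assoc]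

lemma norm_sq_starProjection_span {H ι : Type*} [NormedAddCommGroup H] [InnerProductSpace ℝ H]
    [Fintype ι] {b : ι → H} (hb : Orthonormal ℝ b) (g : H)
    [(Submodule.span ℝ (range b)).HasOrthogonalProjection] :
    ‖(Submodule.span ℝ (range b)).starProjection g‖ ^ 2 = ∑ j, ⟪b j, g⟫_ℝ ^ 2 := by
  have hproj : (Submodule.span ℝ (range b)).starProjection g = ∑ j, ⟪b j, g⟫_ℝ • b j := by
    refine Submodule.eq_starProjection_of_mem_of_inner_eq_zero
      (Submodule.sum_mem _ fun j _ => Submodule.smul_mem _ _ (Submodule.subset_span ⟨j, rfl⟩)) ?_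
    intro w hw
    induction hw using Submodule.span_induction with
    | mem x hx =>
      obtain ⟨j, rfl⟩ := hx
      classical
      rw [inner_sub_left, hb.inner_left_fintype]
      simp [real_inner_comm]
    | zero => simp
    | add x y _ _ hx hy => rw [inner_add_right, hx, hy, add_zero]
    | smul c x _ hx => rw [inner_smul_right, hx, mul_zero]
  rw [hproj, ← real_inner_self_eq_norm_sq, hb.inner_sum]
  simp [sq]

variable {V : Type*} [NormedAddCommGroup V] [InnerProductSpace ℝ V] [FiniteDimensional ℝ V]

/-- The normalized indicator of a dyadic interval of order `N`, times `v`. -/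
def dyadicStep (N k : ℕ) (v : V) : ConnL2 V :=
  Real.sqrt 2 ^ N • (stepL2 (dyadicPt N (k + 1)) v - stepL2 (dyadicPt N k) v)

lemma sqrt_two_pow_sq (N : ℕ) : (Real.sqrt 2 ^ N) * (Real.sqrt 2 ^ N) = 2 ^ N := by
  rw [← mul_pow, Real.mul_self_sqrt (by norm_num)]

lemma inner_dyadicStep_sq (N k : ℕ) (v : V) (g : ConnL2 V) :
    ⟪dyadicStep N k v, g⟫_ℝ ^ 2 =
      2 ^ N * (⟪stepL2 (dyadicPt N (k + 1)) v, g⟫_ℝ - ⟪stepL2 (dyadicPt N k) v, g⟫_ℝ) ^ 2 := by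
  rw [dyadicStep, inner_smul_left, inner_sub_left, mul_pow, ← sqrt_two_pow_sq]
  simp [sq]

lemma orthonormal_dyadicStep {ι : Type*} {v : ι → V} (hv : Orthonormal ℝ v) (N : ℕ) :
    Orthonormal ℝ fun j : Fin (2 ^ N) × ι => dyadicStep N j.1 (v j.2) := by
  classical
  rw [orthonormal_iff_ite]
  rintro ⟨k, i⟩ ⟨l, j⟩
  have hin : ∀ k l : Fin (2 ^ N), ⟪dyadicStep N k (v i), dyadicStep N l (v j)⟫_ℝ =
      2 ^ N * (min (dyadicPt N (k + 1)) (dyadicPt N (l + 1)) -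
        min (dyadicPt N (k + 1)) (dyadicPt N l) - min (dyadicPt N k) (dyadicPt N (l + 1)) +
        min (dyadicPt N k) (dyadicPt N l)) * ⟪v i, v j⟫_ℝ := by
    intro k l
    have h : ∀ k : Fin (2 ^ N), dyadicPt N k ∈ Icc (0 : ℝ) 1 ∧ dyadicPt N (k + 1) ∈ Icc (0 : ℝ) 1 :=
      fun k => ⟨dyadicPt_mem k.2.le, dyadicPt_mem k.2⟩
    rw [dyadicStep, dyadicStep, inner_smul_left, inner_smul_right, inner_sub_left, inner_sub_right,
      inner_sub_right, inner_stepL2_stepL2 (h k).2 (h l).2, inner_stepL2_stepL2 (h k).2 (h l).1,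
      inner_stepL2_stepL2 (h k).1 (h l).2, inner_stepL2_stepL2 (h k).1 (h l).1, ← sqrt_two_pow_sq]
    simp only [conj_trivial]
    ring
  simp only [hin, Prod.mk.injEq]
  rcases lt_trichotomy k l with hkl | rfl | hkl
  · have h1 : dyadicPt N (k + 1) ≤ dyadicPt N l := dyadicPt_mono hkl
    have h2 : dyadicPt N k ≤ dyadicPt N l := dyadicPt_mono (Fin.le_iff_val_le_val.1 hkl.le)
    have h3 : dyadicPt N l ≤ dyadicPt N (l + 1) := dyadicPt_mono (Nat.le_succ _)
    rw [min_eq_left (h1.trans h3), min_eq_left h1, min_eq_left (h2.trans h3), min_eq_left h2,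
      if_neg fun h => hkl.ne h.1]
    ring
  · have h3 : dyadicPt N k ≤ dyadicPt N (k + 1) := dyadicPt_mono (Nat.le_succ _)
    have h4 := dyadicPt_succ_sub N k
    rw [min_self, min_self, min_eq_right h3, min_eq_left h3, orthonormal_iff_ite.1 hv i j]
    have h5 : (2 : ℝ) ^ N * (2 ^ N)⁻¹ = 1 := mul_inv_cancel₀ (by positivity)
    simp only [true_and]
    rw [show dyadicPt N (k + 1) - dyadicPt N k - dyadicPt N k + dyadicPt N k = (2 ^ N)⁻¹ by
      linarith, h5, one_mul]
  · have h1 : dyadicPt N (l + 1) ≤ dyadicPt N k := dyadicPt_mono hkl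
    have h2 : dyadicPt N l ≤ dyadicPt N k := dyadicPt_mono (Fin.le_iff_val_le_val.1 hkl.le)
    have h3 : dyadicPt N k ≤ dyadicPt N (k + 1) := dyadicPt_mono (Nat.le_succ _)
    rw [min_eq_right (h1.trans h3), min_eq_right h1, min_eq_right (h2.trans h3), min_eq_right h2,
      if_neg fun h => hkl.ne' h.1]
    ring

lemma dyadicStep_eq (N k : ℕ) (v : V) :
    dyadicStep N k v = (Real.sqrt 2)⁻¹ •
      (dyadicStep (N + 1) (2 * k) v + dyadicStep (N + 1) (2 * k + 1) v) := by
  have h2 : Real.sqrt 2 ≠ 0 := by positivity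
  simp only [dyadicStep, ← smul_add, smul_smul]
  rw [show 2 * k + 1 + 1 = 2 * (k + 1) by ring, dyadicPt_succ, dyadicPt_succ, pow_succ',
    ← mul_assoc, inv_mul_cancel₀ h2, one_mul]
  congr 1
  abel

/-- The `V`-valued dyadic step functions of all orders are total in `L²([0,1]; V)`: a function
orthogonal to them has an indefinite integral that vanishes at the dyadic points. -/
theorem tendsto_sum_dyadicEnergy {ι : Type*} [Fintype ι] (v : OrthonormalBasis ι ℝ V)
    (g : ConnL2 V) :
    Filter.Tendsto (fun N => ∑ i, dyadicEnergy (fun a => ⟪stepL2 a (v i), g⟫_ℝ) N) Filter.atTop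
      (nhds (‖g‖ ^ 2)) := by
  set b : ∀ N, Fin (2 ^ N) × ι → ConnL2 V := fun N j => dyadicStep N j.1 (v j.2) with hb
  set U : ℕ → Submodule ℝ (ConnL2 V) := fun N => Submodule.span ℝ (range (b N)) with hU
  have hfin : ∀ N, FiniteDimensional ℝ (U N) := fun N =>
    FiniteDimensional.span_of_finite ℝ (finite_range _)
  have hmono : Monotone U := by
    refine monotone_nat_of_le_succ fun N => Submodule.span_le.2 ?_
    rintro _ ⟨⟨k, i⟩, rfl⟩
    simp only [hb, SetLike.mem_coe]
    rw [dyadicStep_eq]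
    have hk := k.2
    have hp : 2 ^ (N + 1) = 2 * 2 ^ N := pow_succ' 2 N
    refine Submodule.smul_mem _ _ (Submodule.add_mem _ (Submodule.subset_span ?_)
      (Submodule.subset_span ?_))
    · exact ⟨(⟨2 * k, by omega⟩, i), rfl⟩
    · exact ⟨(⟨2 * k + 1, by omega⟩, i), rfl⟩
  have hdense : ⊤ ≤ (⨆ N, U N).topologicalClosure := by
    have : CompleteSpace V := FiniteDimensional.complete ℝ V
    rw [top_le_iff, Submodule.topologicalClosure_eq_top_iff, Submodule.eq_bot_iff]
    intro f hf
    have h0 : ∀ N k i, k < 2 ^ N → ⟪dyadicStep N k (v i), f⟫_ℝ = 0 := by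
      intro N k i hk
      refine (Submodule.mem_orthogonal _ _).1 hf _ (le_iSup U N (Submodule.subset_span ?_))
      exact ⟨(⟨k, hk⟩, i), rfl⟩
    have h1 : ∀ N k i, k ≤ 2 ^ N → ⟪stepL2 (dyadicPt N k) (v i), f⟫_ℝ = 0 := by
      intro N k i
      induction k with
      | zero => simp [dyadicPt, stepL2_zero]
      | succ k ih =>
        intro hk
        have h2 := inner_dyadicStep_sq N k (v i) f
        rw [h0 N k i hk, ih (by omega), sub_zero, zero_pow two_ne_zero, eq_comm, mul_eq_zero] at h2
        exact pow_eq_zero_iff two_ne_zero |>.1 (h2.resolve_left (by positivity))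
    have h2 : ∀ N k (hk : k ≤ 2 ^ N),
        pathValue ⟨dyadicPt N k, dyadicPt_mem hk⟩ (inclL2 V f) = 0 := by
      intro N k hk
      rw [← v.sum_repr' (pathValue _ _)]
      refine Finset.sum_eq_zero fun i _ => ?_
      rw [← inner_stepL2 (dyadicPt_mem hk), h1 N k i hk, zero_smul]
    refine eq_zero_of_pathValue_eq_zero fun τ => ?_
    have hlim : Filter.Tendsto (fun N : ℕ => dyadicPt N ⌊(τ : ℝ) * 2 ^ N⌋₊) Filter.atTop
        (nhds (τ : ℝ)) := by
      have := (tendsto_nat_floor_mul_div_atTop (R := ℝ) τ.2.1).comp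
        (tendsto_pow_atTop_atTop_of_one_lt (one_lt_two : (1 : ℝ) < 2))
      exact this
    have hle : ∀ N : ℕ, ⌊(τ : ℝ) * 2 ^ N⌋₊ ≤ 2 ^ N := by
      intro N
      refine Nat.floor_le_of_le ?_
      push_cast
      exact mul_le_of_le_one_left (by positivity) τ.2.2
    have hlim2 : Filter.Tendsto (fun N : ℕ => (⟨dyadicPt N ⌊(τ : ℝ) * 2 ^ N⌋₊,
        dyadicPt_mem (hle N)⟩ : unitInterval)) Filter.atTop (nhds τ) :=
      tendsto_subtype_rng.2 hlim
    have h3 := ((continuous_pathValue (inclL2 V f)).tendsto τ).comp hlim2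
    refine tendsto_nhds_unique h3 ?_
    exact tendsto_const_nhds.congr fun N => (h2 N _ (hle N)).symm
  have hlim := ((Submodule.starProjection_tendsto_self U hmono g hdense).norm).pow 2
  refine hlim.congr fun N => ?_
  rw [norm_sq_starProjection_span (orthonormal_dyadicStep v.orthonormal N), Fintype.sum_prod_type,
    Finset.sum_comm]
  refine Finset.sum_congr rfl fun i _ => ?_
  rw [dyadicEnergy, Finset.mul_sum, ← Fin.sum_univ_eq_sum_range (fun k => 2 ^ N *
    (⟪stepL2 (dyadicPt N (k + 1)) (v i), g⟫_ℝ - ⟪stepL2 (dyadicPt N k) (v i), g⟫_ℝ) ^ 2)]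
  exact Finset.sum_congr rfl fun k _ => inner_dyadicStep_sq _ _ _ _

end Dyadic

/-! ### Wiener measure -/

section WienerMeasure

open scoped InnerProductSpace

variable {V : Type*} [NormedAddCommGroup V] [InnerProductSpace ℝ V] [FiniteDimensional ℝ V]

/-- The Haar functions times `v`: the constant function, and for `k < 2^n` the normalized
difference of the indicators of the two halves of `(k/2^n, (k+1)/2^n]`. -/
def haarL2 : Option (Σ _ : ℕ, ℕ) → V → ConnL2 V
  | none, v => stepL2 1 v
  | some ⟨n, k⟩, v => Real.sqrt 2 ^ n • ((2 : ℝ) • stepL2 (dyadicPt (n + 1) (2 * k + 1)) v -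
      stepL2 (dyadicPt n k) v - stepL2 (dyadicPt n (k + 1)) v)

/-- The labels of the Haar functions of order less than `N`. -/
def haarIndex (N : ℕ) : Finset (Option (Σ _ : ℕ, ℕ)) :=
  Finset.insertNone ((Finset.range N).sigma fun n => Finset.range (2 ^ n))

lemma sum_haarIndex {M : Type*} [AddCommMonoid M] (N : ℕ) (f : Option (Σ _ : ℕ, ℕ) → M) :
    ∑ j ∈ haarIndex N, f j =
      f none + ∑ n ∈ Finset.range N, ∑ k ∈ Finset.range (2 ^ n), f (some ⟨n, k⟩) := by
  rw [haarIndex, Finset.sum_insertNone, Finset.sum_sigma]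

lemma sum_inner_haarL2_sq (v : V) (g : ConnL2 V) (N : ℕ) :
    ∑ j ∈ haarIndex N, ⟪haarL2 j v, g⟫_ℝ ^ 2 = dyadicEnergy (fun a => ⟪stepL2 a v, g⟫_ℝ) N := by
  rw [sum_haarIndex, dyadicEnergy_eq]
  congr 1
  · simp [haarL2, stepL2_zero]
  · refine Finset.sum_congr rfl fun n _ => Finset.sum_congr rfl fun k _ => ?_
    rw [haarL2, inner_smul_left, inner_sub_left, inner_sub_left, inner_smul_left, mul_pow,
      ← sqrt_two_pow_sq]
    simp [sq]

/-- The tent function, up to normalization the indefinite integral of a Haar function. -/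
def tent (n k : ℕ) (τ : ℝ) : ℝ :=
  2 * min (dyadicPt (n + 1) (2 * k + 1)) τ - min (dyadicPt n k) τ - min (dyadicPt n (k + 1)) τ

lemma dyadicPt_mid_mem {n k : ℕ} :
    dyadicPt n k ≤ dyadicPt (n + 1) (2 * k + 1) ∧
      dyadicPt (n + 1) (2 * k + 1) ≤ dyadicPt n (k + 1) := by
  have h1 := dyadicPt_mid n k
  have h2 : dyadicPt n k ≤ dyadicPt n (k + 1) := dyadicPt_mono (Nat.le_succ k)
  constructor <;> linarith

lemma abs_tent_le (n k : ℕ) (τ : ℝ) : |tent n k τ| ≤ (2 ^ n)⁻¹ := by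
  have h1 := dyadicPt_mid n k
  obtain ⟨h2, h3⟩ := dyadicPt_mid_mem (n := n) (k := k)
  rw [← dyadicPt_succ_sub n k, abs_le, tent]
  constructor
  · rcases min_cases (dyadicPt (n + 1) (2 * k + 1)) τ with ⟨h, _⟩ | ⟨h, _⟩ <;>
    rcases min_cases (dyadicPt n k) τ with ⟨h', _⟩ | ⟨h', _⟩ <;>
    rcases min_cases (dyadicPt n (k + 1)) τ with ⟨h'', _⟩ | ⟨h'', _⟩ <;>
    rw [h, h', h''] <;> linarith
  · rcases min_cases (dyadicPt (n + 1) (2 * k + 1)) τ with ⟨h, _⟩ | ⟨h, _⟩ <;>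
    rcases min_cases (dyadicPt n k) τ with ⟨h', _⟩ | ⟨h', _⟩ <;>
    rcases min_cases (dyadicPt n (k + 1)) τ with ⟨h'', _⟩ | ⟨h'', _⟩ <;>
    rw [h, h', h''] <;> linarith

/-- The tent functions of order `n` have disjoint supports. -/
lemma tent_eq_zero {n k : ℕ} {τ : ℝ} (hτ : 0 ≤ τ) (hk : k ≠ ⌊τ * 2 ^ n⌋₊) : tent n k τ = 0 := by
  have h1 := dyadicPt_mid n k
  obtain ⟨h2, h3⟩ := dyadicPt_mid_mem (n := n) (k := k)
  have hp : (0 : ℝ) < 2 ^ n := by positivity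
  rcases lt_or_gt_of_ne hk with h | h
  · have h4 : dyadicPt n (k + 1) ≤ τ := by
      rw [dyadicPt, div_le_iff₀ hp]
      exact (Nat.cast_le.2 (Nat.succ_le_of_lt h)).trans (Nat.floor_le (by positivity))
    rw [tent, min_eq_left h4, min_eq_left (h3.trans h4), min_eq_left ((h2.trans h3).trans h4)]
    linarith
  · have h4 : τ ≤ dyadicPt n k := by
      rw [dyadicPt, le_div_iff₀ hp]
      exact (Nat.lt_of_floor_lt h).le
    rw [tent, min_eq_right h4, min_eq_right (h4.trans h2), min_eq_right (h4.trans (h2.trans h3))]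
    ring

lemma pathValue_haarL2 {n k : ℕ} (hk : k < 2 ^ n) (v : V) (τ : unitInterval) :
    pathValue τ (inclL2 V (haarL2 (some ⟨n, k⟩) v)) = (Real.sqrt 2 ^ n * tent n k τ) • v := by
  have hm : dyadicPt (n + 1) (2 * k + 1) ∈ Icc (0 : ℝ) 1 := by
    refine dyadicPt_mem ?_
    rw [pow_succ']
    omega
  simp only [haarL2, map_smul, map_sub, pathValue_stepL2 hm,
    pathValue_stepL2 (dyadicPt_mem hk.le), pathValue_stepL2 (dyadicPt_mem hk), tent]
  module

/-- A combination of the Haar functions of a single order is small in the norm of `Ā`, since at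
each time at most one of the tent functions is nonzero. -/
lemma norm_sum_haarL2_le (n : ℕ) (v : V) (w : ℕ → ℝ) {B : ℝ}
    (hB : ∀ k < 2 ^ n, |w k| ≤ B) (hB0 : 0 ≤ B) :
    ‖∑ k ∈ Finset.range (2 ^ n), w k • inclL2 V (haarL2 (some ⟨n, k⟩) v)‖ ≤
      B * (Real.sqrt 2 ^ n * (2 ^ n)⁻¹ * ‖v‖) := by
  refine norm_le_of_pathValue_le (by positivity) fun τ => ?_
  rw [map_sum]
  have hterm : ∀ k ∈ Finset.range (2 ^ n),
      pathValue τ (w k • inclL2 V (haarL2 (some ⟨n, k⟩) v)) =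
        (w k * (Real.sqrt 2 ^ n * tent n k τ)) • v := by
    intro k hk
    rw [map_smul, pathValue_haarL2 (Finset.mem_range.1 hk), smul_smul]
  rw [Finset.sum_congr rfl hterm]
  by_cases h0 : ⌊(τ : ℝ) * 2 ^ n⌋₊ ∈ Finset.range (2 ^ n)
  · rw [Finset.sum_eq_single_of_mem _ h0 fun k _ hk => by
      rw [tent_eq_zero τ.2.1 hk, mul_zero, mul_zero, zero_smul]]
    rw [norm_smul, Real.norm_eq_abs, abs_mul, abs_mul, abs_of_nonneg (by positivity :
      (0 : ℝ) ≤ Real.sqrt 2 ^ n), mul_assoc]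
    gcongr
    · exact hB _ (Finset.mem_range.1 h0)
    · exact abs_tent_le _ _ _
  · rw [Finset.sum_eq_zero fun k hk => by
      rw [tent_eq_zero τ.2.1 fun h => h0 (h ▸ hk), mul_zero, mul_zero, zero_smul]]
    rw [norm_zero]
    positivity

lemma abs_le_mul_one_add_pow_four {c : ℝ} (hc : 0 < c) (x : ℝ) :
    |x| ≤ c * (1 + x ^ 4 / c ^ 4) := by
  set u := |x| / c with hu
  have hu0 : 0 ≤ u := by positivity
  have hx : |x| = c * u := by rw [hu]; field_simp
  have hx4 : x ^ 4 / c ^ 4 = u ^ 4 := by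
    rw [hu, div_pow]
    congr 1
    exact (Even.pow_abs (by decide) x).symm
  rw [hx4, hx]
  refine mul_le_mul_of_nonneg_left ?_ hc.le
  nlinarith [sq_nonneg (u ^ 2 - 1 / 2), sq_nonneg (u - 1)]

/-- Fourth moments bound the expected maximum of `2^n` standard Gaussian variables by `2^{n/4}`. -/
lemma integral_norm_haar_level_le {ι : Type*} (i : ι) (v : V) (n : ℕ) :
    ∫ p : Option (Σ _ : ℕ, ℕ) × ι → ℝ,
      ‖∑ k ∈ Finset.range (2 ^ n), p (some ⟨n, k⟩, i) • inclL2 V (haarL2 (some ⟨n, k⟩) v)‖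
        ∂gaussSeq (Option (Σ _ : ℕ, ℕ) × ι) ≤
      (1 + ∫ x, x ^ 4 ∂gaussianReal 0 1) * ‖v‖ * (Real.sqrt (Real.sqrt 2))⁻¹ ^ n := by
  set c : ℝ := Real.sqrt (Real.sqrt 2) ^ n with hc
  have hc0 : 0 < c := by positivity
  have hs : Real.sqrt (Real.sqrt 2) ^ 2 = Real.sqrt 2 := Real.sq_sqrt (Real.sqrt_nonneg _)
  have hc2 : c ^ 2 = Real.sqrt 2 ^ n := by rw [hc, ← pow_mul, mul_comm, pow_mul, hs]
  have hc4 : c ^ 4 = 2 ^ n := by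
    rw [show c ^ 4 = c ^ 2 * c ^ 2 by ring, hc2, sqrt_two_pow_sq]
  set B : (Option (Σ _ : ℕ, ℕ) × ι → ℝ) → ℝ := fun p =>
    c * (1 + (∑ k ∈ Finset.range (2 ^ n), p (some ⟨n, k⟩, i) ^ 4) / c ^ 4) with hB
  have hBi : Integrable B (gaussSeq _) :=
    ((integrable_const 1).add
      ((integrable_finsetSum _ fun k _ => integrable_coord_pow _ 4).div_const _)).const_mul _
  have hle : ∀ p : Option (Σ _ : ℕ, ℕ) × ι → ℝ, ‖∑ k ∈ Finset.range (2 ^ n),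
      p (some ⟨n, k⟩, i) • inclL2 V (haarL2 (some ⟨n, k⟩) v)‖ ≤
      B p * (Real.sqrt 2 ^ n * (2 ^ n)⁻¹ * ‖v‖) := by
    intro p
    refine norm_sum_haarL2_le n v (fun k => p (some ⟨n, k⟩, i)) (fun k hk => ?_) ?_
    · refine (abs_le_mul_one_add_pow_four hc0 _).trans ?_
      simp only [hB]
      gcongr
      exact Finset.single_le_sum (f := fun k => p (some ⟨n, k⟩, i) ^ 4)
        (fun _ _ => by positivity) (Finset.mem_range.2 hk)
    · have : 0 ≤ ∑ k ∈ Finset.range (2 ^ n), p (some ⟨n, k⟩, i) ^ 4 :=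
        Finset.sum_nonneg fun _ _ => by positivity
      simp only [hB]
      positivity
  have hBv : ∫ p, B p ∂gaussSeq (Option (Σ _ : ℕ, ℕ) × ι) =
      c * (1 + ∫ x, x ^ 4 ∂gaussianReal 0 1) := by
    simp only [hB]
    rw [integral_const_mul, integral_add (integrable_const 1)
      ((integrable_finsetSum _ fun k _ => integrable_coord_pow _ 4).div_const _),
      integral_div, integral_finsetSum _ fun k _ => integrable_coord_pow _ 4]
    simp only [integral_coord_pow, Finset.sum_const, Finset.card_range, integral_const, hc4]
    simp
  calc _ ≤ ∫ p, B p * (Real.sqrt 2 ^ n * (2 ^ n)⁻¹ * ‖v‖)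
        ∂gaussSeq (Option (Σ _ : ℕ, ℕ) × ι) :=
        integral_mono_of_nonneg (Filter.Eventually.of_forall fun _ => norm_nonneg _)
          (hBi.mul_const _) (Filter.Eventually.of_forall hle)
    _ = _ := by
        rw [integral_mul_const, hBv, ← hc2, ← hc4, inv_pow, ← hc]
        field_simp

variable (V) in
/-- **Wiener measure**: the Lévy–Ciesielski series, in which the Haar functions have independent
standard Gaussian coefficients, converges uniformly. -/
theorem exists_wienerMeasure : ∃ P : Measure (Abar V), IsProbabilityMeasure P ∧
    ∀ φ : StrongDual ℝ (Abar V),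
      charFunDual P φ = Complex.exp (-((‖φ ∘L inclL2 V‖ ^ 2 : ℝ) / 2)) := by
  have : CompleteSpace V := FiniteDimensional.complete ℝ V
  set v := stdOrthonormalBasis ℝ V with hv
  set m := Module.finrank ℝ V
  refine exists_measure_of_gaussSum
    (fun j : Option (Σ _ : ℕ, ℕ) × Fin m => inclL2 V (haarL2 j.1 (v j.2)))
    (fun N => haarIndex N ×ˢ Finset.univ)
    (C := ∑ _i : Fin m, (1 + ∫ x, x ^ 4 ∂gaussianReal 0 1)) (r := (Real.sqrt (Real.sqrt 2))⁻¹)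
    ?_ (fun n => ?_) (fun φ => ?_)
  · refine inv_lt_one_of_one_lt₀ ?_
    have h : (1 : ℝ) < Real.sqrt 2 := Real.lt_sqrt_of_sq_lt (by norm_num)
    exact Real.lt_sqrt_of_sq_lt (by simpa using h)
  · have hdiff : ∀ p : Option (Σ _ : ℕ, ℕ) × Fin m → ℝ,
        gaussSum (fun j => inclL2 V (haarL2 j.1 (v j.2))) (haarIndex n ×ˢ Finset.univ) p -
          gaussSum (fun j => inclL2 V (haarL2 j.1 (v j.2))) (haarIndex (n + 1) ×ˢ Finset.univ) p =
        -∑ i, ∑ k ∈ Finset.range (2 ^ n),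
          p (some ⟨n, k⟩, i) • inclL2 V (haarL2 (some ⟨n, k⟩) (v i)) := by
      intro p
      rw [gaussSum, gaussSum, Finset.sum_product_right, Finset.sum_product_right,
        ← Finset.sum_sub_distrib, ← Finset.sum_neg_distrib]
      refine Finset.sum_congr rfl fun i _ => ?_
      rw [sum_haarIndex, sum_haarIndex, Finset.sum_range_succ]
      abel
    simp only [hdiff, norm_neg]
    have hi : ∀ i : Fin m, Integrable (fun p : Option (Σ _ : ℕ, ℕ) × Fin m → ℝ =>
        ∑ k ∈ Finset.range (2 ^ n), p (some ⟨n, k⟩, i) •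
          inclL2 V (haarL2 (some ⟨n, k⟩) (v i))) (gaussSeq _) := by
      intro i
      refine integrable_finsetSum _ fun k _ => Integrable.smul_const ?_ _
      simpa using integrable_coord_pow ((some ⟨n, k⟩, i) : Option (Σ _ : ℕ, ℕ) × Fin m) 1
    calc _ ≤ ∫ p, ∑ i, ‖∑ k ∈ Finset.range (2 ^ n), p (some ⟨n, k⟩, i) •
          inclL2 V (haarL2 (some ⟨n, k⟩) (v i))‖ ∂gaussSeq (Option (Σ _ : ℕ, ℕ) × Fin m) :=
          integral_mono (integrable_finsetSum _ fun i _ => hi i).norm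
            (integrable_finsetSum _ fun i _ => (hi i).norm) fun p => norm_sum_le _ _
      _ ≤ _ := by
          rw [integral_finsetSum _ fun i _ => (hi i).norm, Finset.sum_mul]
          refine Finset.sum_le_sum fun i _ => ?_
          refine (integral_norm_haar_level_le i (v i) n).trans (le_of_eq ?_)
          rw [v.orthonormal.1 i, mul_one]
  · set g := (InnerProductSpace.toDual ℝ (ConnL2 V)).symm (φ ∘L inclL2 V) with hg
    have hφ : ∀ f, φ (inclL2 V f) = ⟪f, g⟫_ℝ := by
      intro f
      rw [real_inner_comm, hg, InnerProductSpace.toDual_symm_apply]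
      rfl
    have hn : ‖φ ∘L inclL2 V‖ = ‖g‖ := by rw [hg, LinearIsometryEquiv.norm_map]
    rw [hn]
    refine (tendsto_sum_dyadicEnergy v g).congr fun N => ?_
    rw [Finset.sum_product_right]
    refine Finset.sum_congr rfl fun i _ => ?_
    rw [← sum_inner_haarL2_sq]
    exact Finset.sum_congr rfl fun j _ => by rw [hφ]

end WienerMeasure

/-! ### White noise and frames -/

section WhiteNoise

open scoped InnerProductSpace
open BoundedContinuousFunction (probCharDual probCharDual_apply)

variable {V : Type*} [NormedAddCommGroup V] [InnerProductSpace ℝ V] [FiniteDimensional ℝ V]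

instance : CompleteSpace (AbarC V) := inferInstanceAs (CompleteSpace (Abar V × Abar V))

/-- The element of `L²([0,1]; V)` representing a functional on `Ā`. -/
def riesz : StrongDual ℝ (Abar V) →ₗ[ℝ] ConnL2 V where
  toFun φ :=
    have : CompleteSpace V := FiniteDimensional.complete ℝ V
    (InnerProductSpace.toDual ℝ (ConnL2 V)).symm (φ ∘L inclL2 V)
  map_add' φ ψ := by rw [ContinuousLinearMap.add_comp, map_add]
  map_smul' c φ := by
    refine ext_inner_right ℝ fun f => ?_
    rw [InnerProductSpace.toDual_symm_apply, inner_smul_left, InnerProductSpace.toDual_symm_apply]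
    rfl

lemma inner_riesz (φ : StrongDual ℝ (Abar V)) (f : ConnL2 V) :
    ⟪riesz φ, f⟫_ℝ = φ (inclL2 V f) := by
  have : CompleteSpace V := FiniteDimensional.complete ℝ V
  exact InnerProductSpace.toDual_symm_apply

lemma norm_riesz (φ : StrongDual ℝ (Abar V)) : ‖riesz φ‖ = ‖φ ∘L inclL2 V‖ := by
  have : CompleteSpace V := FiniteDimensional.complete ℝ V
  exact (InnerProductSpace.toDual ℝ (ConnL2 V)).symm.norm_map (φ ∘L inclL2 V)

lemma IsWhiteNoise.charFunDual {v : ℝ} {P : Measure (Abar V)} (hP : IsWhiteNoise v P)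
    (φ : StrongDual ℝ (Abar V)) :
    charFunDual P φ = Complex.exp (-(v / 2) * (‖φ ∘L inclL2 V‖ ^ 2 : ℝ)) := by
  have h := hP.2 φ
  simp only [charFunDual_apply, mul_comm _ Complex.I]
  rw [h]
  push_cast
  rfl

lemma isWhiteNoise_of_charFunDual {v : ℝ} (hv : 0 < v) {P : Measure (Abar V)} [IsFiniteMeasure P]
    (hP : ∀ φ : StrongDual ℝ (Abar V),
      charFunDual P φ = Complex.exp (-(v / 2) * (‖φ ∘L inclL2 V‖ ^ 2 : ℝ))) :
    IsWhiteNoise v P := by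
  refine ⟨isGaussian_of_charFunDual (q := fun φ => v * ‖φ ∘L inclL2 V‖ ^ 2)
    (fun φ => by positivity) (fun u φ => ?_) (fun φ => ?_), fun φ => ?_⟩
  · rw [← norm_riesz, ← norm_riesz, map_smul, norm_smul, mul_pow, Real.norm_eq_abs, sq_abs]
    ring
  · rw [hP]
    congr 1
    push_cast
    ring
  · have h := hP φ
    simp only [charFunDual_apply, mul_comm _ Complex.I] at h
    rw [h]
    push_cast
    rfl

variable (V) in
theorem exists_isWhiteNoise {v : ℝ} (hv : 0 < v) : ∃ P : Measure (Abar V), IsWhiteNoise v P := by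
  obtain ⟨P, hP, hφ⟩ := exists_wienerMeasure V
  have : IsFiniteMeasure (P.map (Real.sqrt v • ContinuousLinearMap.id ℝ (Abar V))) := by
    infer_instance
  refine ⟨_, isWhiteNoise_of_charFunDual hv
    (P := P.map (Real.sqrt v • ContinuousLinearMap.id ℝ (Abar V))) fun φ => ?_⟩
  rw [charFunDual_map, hφ]
  have h : φ ∘L (Real.sqrt v • ContinuousLinearMap.id ℝ (Abar V)) = Real.sqrt v • φ := by
    ext f
    simp
  rw [h, ← norm_riesz, ← norm_riesz, map_smul, norm_smul, mul_pow, Real.norm_eq_abs,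
    sq_abs, Real.sq_sqrt hv.le]
  congr 1
  push_cast
  ring

theorem IsWhiteNoise.unique {v : ℝ} {P Q : Measure (Abar V)} (hP : IsWhiteNoise v P)
    (hQ : IsWhiteNoise v Q) : P = Q := by
  have := hP.1
  have := hQ.1
  exact Measure.ext_of_charFunDual (funext fun φ => by rw [hP.charFunDual, hQ.charFunDual])

/-- Complex white noise has independent real and imaginary parts. -/
theorem isComplexWhiteNoise_iff {s t : ℝ} {P Q : Measure (Abar V)}
    (hP : IsWhiteNoise (s - t / 2) P) (hQ : IsWhiteNoise (t / 2) Q) (M : Measure (AbarC V)) :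
    IsComplexWhiteNoise s t M ↔ M = P.prod Q := by
  have := hP.1
  have := hQ.1
  have hchar : ∀ φ ψ : StrongDual ℝ (Abar V),
      ∫ C, Complex.exp (Complex.I * φ C.1 + Complex.I * ψ C.2) ∂(P.prod Q) =
      Real.exp (-(1 / 4) *
        (2 * (s - t / 2) * ‖φ ∘L inclL2 V‖ ^ 2 + t * ‖ψ ∘L inclL2 V‖ ^ 2)) := by
    intro φ ψ
    simp only [Complex.exp_add]
    rw [integral_prod_mul (fun A => Complex.exp (Complex.I * φ A))
      (fun B => Complex.exp (Complex.I * ψ B)), hP.2, hQ.2, ← Complex.ofReal_mul, ← Real.exp_add]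
    congr 2
    ring
  constructor
  · intro hM
    have := hM.1
    refine Measure.ext_of_charFunDual (funext fun L => ?_)
    have hL : ∀ C : AbarC V, Complex.exp (L C * Complex.I) =
        Complex.exp (Complex.I * (L ∘L .inl ℝ _ _) C.1 + Complex.I * (L ∘L .inr ℝ _ _) C.2) := by
      intro C
      have h : L C = (L ∘L .inl ℝ _ _) C.1 + (L ∘L .inr ℝ _ _) C.2 := by
        simp only [ContinuousLinearMap.comp_apply, ← map_add]
        simp
      rw [h]
      push_cast
      ring_nf
    rw [charFunDual_apply, charFunDual_apply]
    simp only [hL]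
    rw [hM.2, hchar]
  · rintro rfl
    exact ⟨inferInstance, hchar⟩

lemma isFrame_iff_riesz {d : ℕ} {e : Fin d → ConnL2 V} {ℓ : Fin d → (Abar V →L[ℝ] ℝ)} :
    IsFrame e ℓ ↔ Orthonormal ℝ e ∧ ∀ j, riesz (ℓ j) = e j := by
  refine and_congr_right fun _ => forall_congr' fun j => ⟨fun h => ?_, fun h f => ?_⟩
  · exact ext_inner_right ℝ fun f => by rw [inner_riesz, h]
  · rw [← inner_riesz, h]

lemma IsFrame.norm_riesz_sum_sq {d : ℕ} {e : Fin d → ConnL2 V} {ℓ : Fin d → (Abar V →L[ℝ] ℝ)}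
    (h : IsFrame e ℓ) (c : Fin d → ℝ) : ‖(∑ k, c k • ℓ k) ∘L inclL2 V‖ ^ 2 = ∑ k, c k ^ 2 := by
  obtain ⟨h1, h2⟩ := isFrame_iff_riesz.1 h
  rw [← norm_riesz, map_sum, ← real_inner_self_eq_norm_sq]
  simp only [map_smul, h2]
  rw [h1.inner_sum]
  simp [sq]

/-- Finitely many functionals on `Ā` are combinations of a common frame, up to functionals that
vanish on `𝒜`. -/
theorem exists_frame {ι : Type*} [Finite ι] (φ : ι → StrongDual ℝ (Abar V)) :
    ∃ (d : ℕ) (e : Fin d → ConnL2 V) (ℓ : Fin d → (Abar V →L[ℝ] ℝ)), IsFrame e ℓ ∧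
      ∀ i, ∃ c : Fin d → ℝ, riesz (φ i - ∑ k, c k • ℓ k) = 0 := by
  set U : Submodule ℝ (ConnL2 V) := Submodule.span ℝ (range fun i => riesz (φ i)) with hU
  have hfin : FiniteDimensional ℝ U := FiniteDimensional.span_of_finite ℝ (finite_range _)
  set b := stdOrthonormalBasis ℝ U with hb
  have hrange : U ≤ LinearMap.range (riesz (V := V)) := by
    rw [hU, Submodule.span_le]
    rintro _ ⟨i, rfl⟩
    exact ⟨φ i, rfl⟩
  choose ℓ hℓ using fun k => hrange (b k).2
  refine ⟨_, fun k => (b k : ConnL2 V), ℓ, isFrame_iff_riesz.2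
    ⟨b.orthonormal.comp_linearIsometry U.subtypeₗᵢ, hℓ⟩, fun i => ?_⟩
  have hi : riesz (φ i) ∈ U := Submodule.subset_span ⟨i, rfl⟩
  refine ⟨fun k => ⟪b k, (⟨riesz (φ i), hi⟩ : U)⟫_ℝ, ?_⟩
  rw [map_sub, map_sum, sub_eq_zero]
  simp only [map_smul, hℓ]
  have h := congrArg U.subtype (b.sum_repr' ⟨riesz (φ i), hi⟩)
  rw [map_sum] at h
  exact h.symm

/-- A functional that vanishes on `𝒜` is a centred Gaussian variable of variance zero. Knowing this
almost everywhere makes the density of `𝒜` in `Ā` unnecessary. -/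
lemma IsWhiteNoise.ae_eq_zero {v : ℝ} {P : Measure (Abar V)} (hP : IsWhiteNoise v P)
    {φ : StrongDual ℝ (Abar V)} (hφ : riesz φ = 0) : ∀ᵐ A ∂P, φ A = 0 := by
  have := hP.1
  have h : P.map φ = Measure.dirac 0 := by
    refine Measure.ext_of_charFun (funext fun u => ?_)
    rw [charFun_map_eq_charFunDual_smul, hP.charFunDual, ← norm_riesz, map_smul, hφ]
    simp
  have h2 : ∀ᵐ x ∂(P.map φ), x = 0 := by
    rw [h]
    exact (ae_dirac_iff (measurableSet_singleton 0)).2 rfl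
  exact ae_of_ae_map φ.continuous.measurable.aemeasurable h2

variable {d : ℕ} {e : Fin d → ConnL2 V} {ℓ : Fin d → (Abar V →L[ℝ] ℝ)}

lemma measurable_frameEval (ℓ : Fin d → (Abar V →L[ℝ] ℝ)) : Measurable (frameEval ℓ) :=
  measurable_pi_lambda _ fun j => (ℓ j).continuous.measurable

/-- In the coordinates of a frame, white noise of variance `v` is a Gaussian vector with
covariance `v` times the identity. -/
theorem IsFrame.map_frameEval (h : IsFrame e ℓ) {v : ℝ} (hv : 0 < v) {P : Measure (Abar V)}
    (hP : IsWhiteNoise v P) : P.map (frameEval ℓ) = gaussMeasure d v := by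
  have := hP.1
  have := isProbabilityMeasure_gaussMeasure (d := d) hv
  have : IsFiniteMeasure (P.map (frameEval ℓ)) := by infer_instance
  refine Measure.ext_of_charFunDual (funext fun L => ?_)
  have hpi : P.map (frameEval ℓ) = P.map (ContinuousLinearMap.pi ℓ) := rfl
  have hL : L ∘L ContinuousLinearMap.pi ℓ = ∑ k, L (Pi.single k 1) • ℓ k := by
    ext A
    rw [ContinuousLinearMap.comp_apply, pi_eq_sum_univ' (ContinuousLinearMap.pi ℓ A), map_sum]
    simp [mul_comm]
  rw [charFunDual_gaussMeasure hv, hpi, charFunDual_map, hP.charFunDual, hL, h.norm_riesz_sum_sq]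
  push_cast
  rfl

theorem IsFrame.map_frameEval_prod (h : IsFrame e ℓ) {a b : ℝ} (ha : 0 < a) (hb : 0 < b)
    {P Q : Measure (Abar V)} (hP : IsWhiteNoise a P) (hQ : IsWhiteNoise b Q) :
    (P.prod Q).map (fun C => (frameEval ℓ C.1, frameEval ℓ C.2)) = gaussPair d a b := by
  have := hP.1
  have := hQ.1
  rw [gaussPair, ← h.map_frameEval ha hP, ← h.map_frameEval hb hQ,
    Measure.map_prod_map _ _ (measurable_frameEval ℓ) (measurable_frameEval ℓ)]
  rfl

end WhiteNoise

/-! ### The transform on characters and on cylinder functions -/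

section Transform

open scoped InnerProductSpace ComplexConjugate
open BoundedContinuousFunction (probCharDual probCharDual_apply)

variable {V : Type*} [NormedAddCommGroup V] [InnerProductSpace ℝ V] [FiniteDimensional ℝ V]

lemma IsWhiteNoise.map_eq_gaussianReal {v : ℝ} (hv : 0 < v) {P : Measure (Abar V)}
    (hP : IsWhiteNoise v P) (φ : StrongDual ℝ (Abar V)) :
    P.map φ = gaussianReal 0 (v * ‖riesz φ‖ ^ 2).toNNReal := by
  have := hP.1
  refine Measure.ext_of_charFun (funext fun u => ?_)
  rw [charFun_map_eq_charFunDual_smul, hP.charFunDual, ← norm_riesz, map_smul, norm_smul, mul_pow,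
    Real.norm_eq_abs, sq_abs, charFun_gaussianReal, Real.coe_toNNReal _ (by positivity)]
  congr 1
  push_cast
  ring

lemma IsWhiteNoise.integrable_exp {v : ℝ} (hv : 0 < v) {P : Measure (Abar V)}
    (hP : IsWhiteNoise v P) (φ : StrongDual ℝ (Abar V)) :
    Integrable (fun A => Real.exp (φ A)) P := by
  have h := integrable_exp_mul_gaussianReal (μ := 0) (v := (v * ‖riesz φ‖ ^ 2).toNNReal) 1
  rw [← hP.map_eq_gaussianReal hv φ, integrable_map_measure
    (Continuous.aestronglyMeasurable (by fun_prop)) φ.continuous.measurable.aemeasurable] at h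
  simpa [Function.comp_def] using h

lemma IsWhiteNoise.integral_exp {v : ℝ} (hv : 0 < v) {P : Measure (Abar V)}
    (hP : IsWhiteNoise v P) (φ : StrongDual ℝ (Abar V)) :
    ∫ A, Real.exp (φ A) ∂P = Real.exp (v / 2 * ‖riesz φ‖ ^ 2) := by
  have h := mgf_gaussianReal (hP.map_eq_gaussianReal hv φ) 1
  rw [Real.coe_toNNReal _ (by positivity)] at h
  simp only [mgf, one_mul] at h
  rw [h]
  congr 1
  ring

/-- The image of the character `A ↦ exp (i φ(A))` under the transform: the holomorphic function
`C ↦ exp (i φ(C) - t ‖φ‖² / 2)`. -/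
def holomorphicChar (t : ℝ) (φ : StrongDual ℝ (Abar V)) (C : AbarC V) : ℂ :=
  Complex.exp (Complex.I * (φ C.1 + Complex.I * φ C.2) - (t / 2 * ‖riesz φ‖ ^ 2 : ℝ))

lemma holomorphicChar_eq (t : ℝ) (φ : StrongDual ℝ (Abar V)) (C : AbarC V) :
    holomorphicChar t φ C = Complex.exp (Complex.I * φ C.1) *
      ((Real.exp (-(φ C.2)) * Real.exp (-(t / 2 * ‖riesz φ‖ ^ 2)) : ℝ) : ℂ) := by
  rw [holomorphicChar, ← Real.exp_add, Complex.ofReal_exp, ← Complex.exp_add]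
  congr 1
  push_cast
  linear_combination (φ C.2 : ℂ) * Complex.I_sq

variable {s t : ℝ} {P P' Q : Measure (Abar V)}

lemma memLp_holomorphicChar (ht : 0 < t / 2) (hP' : IsWhiteNoise (s - t / 2) P')
    (hQ : IsWhiteNoise (t / 2) Q) (φ : StrongDual ℝ (Abar V)) :
    MemLp (holomorphicChar t φ) 2 (P'.prod Q) := by
  have := hP'.1
  have := hQ.1
  have hc : Continuous (holomorphicChar t φ) := by
    unfold holomorphicChar
    fun_prop
  rw [memLp_two_iff_integrable_sq_norm hc.aestronglyMeasurable]
  have h := ((hQ.integrable_exp ht (-(2 : ℝ) • φ)).comp_snd P').mul_const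
    (Real.exp (-(t / 2 * ‖riesz φ‖ ^ 2)) ^ 2)
  refine h.congr (Filter.Eventually.of_forall fun C => ?_)
  beta_reduce
  rw [holomorphicChar_eq, norm_mul, mul_comm Complex.I, Complex.norm_exp_ofReal_mul_I, one_mul,
    Complex.norm_real, Real.norm_eq_abs, sq_abs, mul_pow]
  congr 1
  rw [← Real.exp_nat_mul]
  congr 1
  simp

/-- The functions `C ↦ exp (i φ(C) - t ‖φ‖² / 2)` have the same inner products as the characters
`A ↦ exp (i φ(A))`. -/
lemma inner_holomorphicChar (ht : 0 < t / 2) (hP : IsWhiteNoise s P)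
    (hP' : IsWhiteNoise (s - t / 2) P') (hQ : IsWhiteNoise (t / 2) Q)
    [IsFiniteMeasure P] (φ ψ : StrongDual ℝ (Abar V)) :
    ⟪charLp P φ, charLp P ψ⟫_ℂ =
      ⟪(memLp_holomorphicChar ht hP' hQ φ).toLp _,
        (memLp_holomorphicChar ht hP' hQ ψ).toLp _⟫_ℂ := by
  have := hP'.1
  have := hQ.1
  have h1 : ⟪charLp P φ, charLp P ψ⟫_ℂ = Complex.exp (-(s / 2) * (‖riesz (ψ - φ)‖ ^ 2 : ℝ)) := by
    rw [norm_riesz, ← hP.charFunDual, L2.inner_def, charFunDual]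
    refine integral_congr_ae ?_
    filter_upwards [coeFn_charLp P φ, coeFn_charLp P ψ] with A hφ hψ
    rw [hφ, hψ, RCLike.inner_apply, ← probCharDual_neg_apply]
    simp only [probCharDual_apply, ← Complex.exp_add]
    congr 1
    simp
    ring
  have h2 : ⟪(memLp_holomorphicChar ht hP' hQ φ).toLp _,
      (memLp_holomorphicChar ht hP' hQ ψ).toLp _⟫_ℂ =
      ∫ C, Complex.exp (Complex.I * (ψ - φ) C.1) * ((Real.exp ((-(φ + ψ)) C.2) : ℝ) *
        (Real.exp (-(t / 2 * (‖riesz φ‖ ^ 2 + ‖riesz ψ‖ ^ 2))) : ℝ) : ℂ) ∂(P'.prod Q) := by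
    rw [L2.inner_def]
    refine integral_congr_ae ?_
    filter_upwards [(memLp_holomorphicChar ht hP' hQ φ).coeFn_toLp,
      (memLp_holomorphicChar ht hP' hQ ψ).coeFn_toLp] with C hφ hψ
    rw [hφ, hψ, RCLike.inner_apply, holomorphicChar, holomorphicChar, ← Complex.exp_conj,
      ← Complex.exp_add]
    push_cast
    rw [← Complex.exp_add, ← Complex.exp_add]
    congr 1
    have h2 : (starRingEnd ℂ) 2 = 2 := Complex.conj_ofNat 2
    simp [h2]
    linear_combination ((φ C.2 : ℂ) + ψ C.2) * Complex.I_sq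
  rw [h1, h2, integral_prod_mul (fun A => Complex.exp (Complex.I * (ψ - φ) A)) (fun B =>
    ((Real.exp ((-(φ + ψ)) B) : ℝ) *
        (Real.exp (-(t / 2 * (‖riesz φ‖ ^ 2 + ‖riesz ψ‖ ^ 2))) : ℝ) : ℂ)), hP'.2,
    integral_mul_const, integral_complex_ofReal, hQ.integral_exp ht, ← norm_riesz,
    ← Complex.ofReal_mul, ← Complex.ofReal_mul, ← Real.exp_add, ← Real.exp_add,
    Complex.ofReal_exp]
  congr 1
  have hpar := parallelogram_law_with_norm ℝ (riesz φ) (riesz ψ)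
  rw [map_neg, norm_neg, map_add, map_sub, norm_sub_rev]
  norm_cast
  linear_combination (-(t / 4)) * hpar

/-- A function `φ` in `L²` of the Gaussian measure, transformed in the coordinates of a frame, is
the image of the corresponding cylinder function under any isometry with the right values on the
characters. -/
theorem apply_cylinder (ht : 0 < t / 2) (hst : t / 2 < s) (hP : IsWhiteNoise s P)
    (hP' : IsWhiteNoise (s - t / 2) P') (hQ : IsWhiteNoise (t / 2) Q) [IsFiniteMeasure P]
    {S : Lp ℂ 2 P →ₗᵢ[ℂ] Lp ℂ 2 (P'.prod Q)}
    (hS : ∀ φ, S (charLp P φ) = (memLp_holomorphicChar ht hP' hQ φ).toLp _)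
    {d : ℕ} {e : Fin d → ConnL2 V} {ℓ : Fin d → (Abar V →L[ℝ] ℝ)} (hℓ : IsFrame e ℓ)
    {φ : (Fin d → ℝ) → ℂ} (hφ : Measurable φ) (hf : MemLp (fun A => φ (frameEval ℓ A)) 2 P) :
    S (hf.toLp _) =ᵐ[P'.prod Q] fun C => segalBargmann t φ (frameEvalC ℓ C) := by
  have hs : 0 < s := ht.trans hst
  have ht' : 0 < t := by linarith
  have := isProbabilityMeasure_gaussMeasure (d := d) hs
  have hmp : MeasurePreserving (frameEval ℓ) P (gaussMeasure d s) :=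
    ⟨measurable_frameEval ℓ, hℓ.map_frameEval hs hP⟩
  set T : Lp ℂ 2 (gaussMeasure d s) →L[ℂ] Lp ℂ 2 (P'.prod Q) :=
    (S.comp (Lp.compMeasurePreservingₗᵢ ℂ (frameEval ℓ) hmp)).toContinuousLinearMap with hT
  set h : AbarC V → Lp ℂ 2 (gaussMeasure d s) := fun C =>
    (memLp_transformKernel ht' hst (frameEvalC ℓ C)).toLp _ with hh
  have hinner : ∀ C (g : (Fin d → ℝ) → ℂ) (hg : MemLp g 2 (gaussMeasure d s)),
      ⟪h C, hg.toLp g⟫_ℂ = segalBargmann t g (frameEvalC ℓ C) := by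
    intro C g hg
    rw [segalBargmann_eq_integral hs, L2.inner_def]
    refine integral_congr_ae ?_
    filter_upwards [hg.coeFn_toLp, (memLp_transformKernel ht' hst (frameEvalC ℓ C)).coeFn_toLp]
      with x hx1 hx2
    rw [hx1, hx2, RCLike.inner_apply, mul_comm]
  have hTg : ∀ (g : (Fin d → ℝ) → ℂ) (hg : MemLp g 2 (gaussMeasure d s)),
      T (hg.toLp g) = S ((hg.comp_measurePreserving hmp).toLp _) := fun g hg => rfl
  have hchar : ∀ L : StrongDual ℝ (Fin d → ℝ), charLp (gaussMeasure d s) L ∈ evalSubmodule T h := by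
    intro L
    set c : Fin d → ℝ := fun k => L (Pi.single k 1) with hc
    have hLx : ∀ x, L x = ∑ k, c k * x k := by
      intro x
      conv_lhs => rw [pi_eq_sum_univ' x, map_sum]
      simp [hc, mul_comm]
    change T (charLp (gaussMeasure d s) L) =ᵐ[P'.prod Q] _
    have h1 : T (charLp (gaussMeasure d s) L) = S (charLp P (∑ k, c k • ℓ k)) := by
      rw [charLp, hTg]
      congr 1
      refine MemLp.toLp_congr _ _ (Filter.Eventually.of_forall fun A => ?_)
      simp only [Function.comp_apply, probCharDual_apply, hLx, frameEval]
      simp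
    rw [h1, hS]
    filter_upwards [(memLp_holomorphicChar ht hP' hQ (∑ k, c k • ℓ k)).coeFn_toLp] with C hC
    have hq : (probCharDual L : (Fin d → ℝ) → ℂ) = quadExp 0 fun k => Complex.I * c k := by
      ext x
      rw [probCharDual_apply, hLx, quadExp]
      congr 1
      push_cast
      rw [zero_mul, zero_add, Finset.sum_mul]
      exact Finset.sum_congr rfl fun k _ => by ring
    rw [hC, charLp, hinner, hq, segalBargmann_exp ht', holomorphicChar, norm_riesz,
      hℓ.norm_riesz_sum_sq]
    congr 1
    simp only [frameEvalC, mul_pow, Complex.I_sq]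
    simp
    simp only [Finset.mul_sum, ← Finset.sum_add_distrib, ← Finset.sum_sub_distrib]
    simp only [sub_eq_add_neg, ← Finset.sum_neg_distrib, ← Finset.sum_add_distrib]
    refine Finset.sum_congr rfl fun k _ => ?_
    ring
  have htop : evalSubmodule T h = ⊤ := by
    rw [← top_le_iff, ← topologicalClosure_span_charLp]
    refine Submodule.topologicalClosure_minimal _ (Submodule.span_le.2 ?_)
      (isClosed_evalSubmodule T h)
    rintro _ ⟨L, rfl⟩
    exact hchar L
  have hφL : MemLp φ 2 (gaussMeasure d s) := by
    rw [← hmp.map_eq]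
    exact (memLp_map_measure_iff hφ.aestronglyMeasurable hmp.measurable.aemeasurable).2 hf
  have hmem : hφL.toLp φ ∈ evalSubmodule T h := by
    rw [htop]
    trivial
  have hmem' : T (hφL.toLp φ) =ᵐ[P'.prod Q] fun C => ⟪h C, hφL.toLp φ⟫_ℂ := hmem
  simp only [hinner, hTg] at hmem'
  exact hmem'

end Transform

/-! ### The image of the transform -/

section Range

open scoped InnerProductSpace ComplexConjugate
open BoundedContinuousFunction (probCharDual probCharDual_apply)

variable {V : Type*} [NormedAddCommGroup V] [InnerProductSpace ℝ V] [FiniteDimensional ℝ V]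
variable {s t : ℝ} {P P' Q : Measure (Abar V)}
variable {d : ℕ} {e : Fin d → ConnL2 V} {ℓ : Fin d → (Abar V →L[ℝ] ℝ)}

/-- Inner products with the kernel functions evaluate holomorphic cylinder functions. -/
lemma IsFrame.inner_pairKernel (hℓ : IsFrame e ℓ) {a b : ℝ} (ha : 0 < a) (hb : 0 < b)
    (hP' : IsWhiteNoise a P') (hQ : IsWhiteNoise b Q) {w : Fin d → ℂ} {Φ : (Fin d → ℂ) → ℂ}
    (hΦ : Differentiable ℂ Φ) {K G : Lp ℂ 2 (P'.prod Q)}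
    (hK : K =ᵐ[P'.prod Q] fun C => pairKernel a b w (frameEvalC ℓ C))
    (hG : G =ᵐ[P'.prod Q] fun C => Φ (frameEvalC ℓ C)) :
    ⟪K, G⟫_ℂ = pairConst d a b *
      (Φ w * Complex.exp (-((1 / a - 1 / b) / 8 : ℝ) * ∑ k, w k ^ 2)) := by
  set Z : AbarC V → (Fin d → ℝ) × (Fin d → ℝ) :=
    fun C => (frameEval ℓ C.1, frameEval ℓ C.2) with hZ
  have hZm : Measurable Z := ((measurable_frameEval ℓ).comp measurable_fst).prodMk
    ((measurable_frameEval ℓ).comp measurable_snd)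
  have hmap : (P'.prod Q).map Z = gaussPair d a b := hℓ.map_frameEval_prod ha hb hP' hQ
  have hc : Continuous fun p : (Fin d → ℝ) × (Fin d → ℝ) =>
      conj (pairKernel a b w (complexPoint p)) * Φ (complexPoint p) := by
    have h0 : Continuous (complexPoint (d := d)) := by
      unfold complexPoint
      fun_prop
    exact (Complex.continuous_conj.comp ((differentiable_pairKernel a b w).continuous.comp h0)).mul
      (hΦ.continuous.comp h0)
  have hae : (fun C => ⟪K C, G C⟫_ℂ) =ᵐ[P'.prod Q]
      fun C => conj (pairKernel a b w (complexPoint (Z C))) * Φ (complexPoint (Z C)) := by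
    filter_upwards [hK, hG] with C h1 h2
    rw [h1, h2, RCLike.inner_apply, mul_comm]
    rfl
  have hi := (L2.integrable_inner (𝕜 := ℂ) K G).congr hae
  rw [L2.inner_def, integral_congr_ae hae, ← integral_pairKernel_mul ha hb hΦ w, ← hmap,
    integral_map hZm.aemeasurable hc.aestronglyMeasurable]
  rw [← hmap]
  exact (integrable_map_measure hc.aestronglyMeasurable hZm.aemeasurable).2 hi

/-- The kernel functions of a frame span a dense subspace of the space of its holomorphic cylinder
functions. The orthogonal projection of such a function onto their closed span has the same inner
products with them, and these determine it almost everywhere because the evaluation relation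
passes to the closed span. -/
theorem IsFrame.mem_closure_span_pairKernel (hℓ : IsFrame e ℓ) {a b : ℝ} (ha : 0 < a) (hb : 0 < b)
    (hP' : IsWhiteNoise a P') (hQ : IsWhiteNoise b Q) {K : (Fin d → ℂ) → Lp ℂ 2 (P'.prod Q)}
    (hK : ∀ w, K w =ᵐ[P'.prod Q] fun C => pairKernel a b w (frameEvalC ℓ C))
    {Φ : (Fin d → ℂ) → ℂ} (hΦ : Differentiable ℂ Φ) {G : Lp ℂ 2 (P'.prod Q)}
    (hG : G =ᵐ[P'.prod Q] fun C => Φ (frameEvalC ℓ C)) :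
    G ∈ (Submodule.span ℂ (range K)).topologicalClosure := by
  -- the multiple of the kernel at `frameEvalC ℓ C` whose inner products are the values at `C`
  set h : AbarC V → Lp ℂ 2 (P'.prod Q) := fun C =>
    conj ((pairConst d a b)⁻¹ *
      Complex.exp (((1 / a - 1 / b) / 8 : ℝ) * ∑ k, frameEvalC ℓ C k ^ 2)) • K (frameEvalC ℓ C)
    with hh
  set 𝓗 := evalSubmodule (ContinuousLinearMap.id ℂ (Lp ℂ 2 (P'.prod Q))) h with hH
  have hmem : ∀ (Ψ : (Fin d → ℂ) → ℂ), Differentiable ℂ Ψ → ∀ F : Lp ℂ 2 (P'.prod Q),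
      (F =ᵐ[P'.prod Q] fun C => Ψ (frameEvalC ℓ C)) → F ∈ 𝓗 := by
    intro Ψ hΨ F hF
    change F =ᵐ[P'.prod Q] fun C => ⟪h C, F⟫_ℂ
    filter_upwards [hF] with C hC
    rw [hC, hh, inner_smul_left, Complex.conj_conj,
      hℓ.inner_pairKernel ha hb hP' hQ hΨ (hK _) hF, neg_mul, Complex.exp_neg]
    have := pairConst_ne_zero (d := d) ha hb
    field_simp [Complex.exp_ne_zero]
  set U := (Submodule.span ℂ (range K)).topologicalClosure with hU
  have hUH : U ≤ 𝓗 := by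
    refine Submodule.topologicalClosure_minimal _ (Submodule.span_le.2 ?_)
      (isClosed_evalSubmodule _ h)
    rintro _ ⟨w, rfl⟩
    exact hmem _ (differentiable_pairKernel a b w) _ (hK w)
  have hUc : IsClosed (U : Set (Lp ℂ 2 (P'.prod Q))) := Submodule.isClosed_topologicalClosure _
  have : CompleteSpace U := hUc.completeSpace_coe
  have hr : G - U.starProjection G ∈ 𝓗 :=
    𝓗.sub_mem (hmem Φ hΦ G hG) (hUH (Submodule.starProjection_apply_mem U G))
  have h0 : ∀ w, ⟪K w, G - U.starProjection G⟫_ℂ = 0 := fun w =>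
    U.sub_starProjection_mem_orthogonal G _
      (Submodule.le_topologicalClosure _ (Submodule.subset_span ⟨w, rfl⟩))
  have hz : G - U.starProjection G = 0 := by
    have hr' : ((G - U.starProjection G : Lp ℂ 2 (P'.prod Q)) : AbarC V → ℂ) =ᵐ[P'.prod Q]
      fun C => ⟪h C, G - U.starProjection G⟫_ℂ := hr
    refine Lp.ext ?_
    filter_upwards [hr', Lp.coeFn_zero ℂ 2 (P'.prod Q)] with C h1 h2
    rw [h1, h2, hh, inner_smul_left, h0, mul_zero]
    rfl
  rw [sub_eq_zero.1 hz]
  exact Submodule.starProjection_apply_mem U G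

/-- Each kernel function of a frame is the image of a Gaussian cylinder function. -/
theorem exists_apply_eq_pairKernel (ht : 0 < t / 2) (hst : t / 2 < s) (hP : IsWhiteNoise s P)
    (hP' : IsWhiteNoise (s - t / 2) P') (hQ : IsWhiteNoise (t / 2) Q) [IsFiniteMeasure P]
    {S : Lp ℂ 2 P →ₗᵢ[ℂ] Lp ℂ 2 (P'.prod Q)}
    (hS : ∀ φ, S (charLp P φ) = (memLp_holomorphicChar ht hP' hQ φ).toLp _)
    (hℓ : IsFrame e ℓ) (w : Fin d → ℂ) :
    ∃ f, S f =ᵐ[P'.prod Q] fun C => pairKernel (s - t / 2) (t / 2) w (frameEvalC ℓ C) := by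
  have hs : 0 < s := ht.trans hst
  have ht' : 0 < t := by linarith
  have ha : 0 < s - t / 2 := sub_pos.2 hst
  -- `β` makes the coefficient of `z²` in the transform equal to `(1/a - 1/b)/8`
  set β : ℝ := (s - t / 2) / (t * s) with hβd
  have hβ : 0 < β := by positivity
  set l : Fin d → ℂ := fun k => conj (w k) / t with hl
  have hγ : 1 / (2 * t) - β < 1 / (4 * s) := by
    have : 1 / (4 * s) - (1 / (2 * t) - β) = (s - t / 2) / (2 * t * s) := by
      rw [hβd]
      field_simp
      ring
    have h2 : 0 < (s - t / 2) / (2 * t * s) := by positivity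
    linarith
  have hL := memLp_quadExp hs hγ l
  have hmp : MeasurePreserving (frameEval ℓ) P (gaussMeasure d s) :=
    ⟨measurable_frameEval ℓ, hℓ.map_frameEval hs hP⟩
  have hf : MemLp (fun A => quadExp (1 / (2 * t) - β) l (frameEval ℓ A)) 2 P :=
    hL.comp_measurePreserving hmp
  have hmeas : Measurable (quadExp (1 / (2 * t) - β) l) := by
    refine Continuous.measurable ?_
    unfold quadExp
    fun_prop
  have hcyl := apply_cylinder ht hst hP hP' hQ hS hℓ hmeas hf
  set A : ℂ := (((2 * Real.pi * t) ^ (-(d : ℝ) / 2) : ℝ) : ℂ) *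
    ((Real.pi / β : ℂ) ^ ((Fintype.card (Fin d) : ℂ) / 2)) *
    Complex.exp ((∑ k, conj (w k) ^ 2) / (4 * β * t ^ 2)) with hA
  have hA0 : A ≠ 0 := by
    refine mul_ne_zero (mul_ne_zero ?_ ?_) (Complex.exp_ne_zero _)
    · exact_mod_cast (Real.rpow_pos_of_pos (by positivity) _).ne'
    · rw [Ne, Complex.cpow_eq_zero_iff, not_and_or]
      left
      exact_mod_cast (div_pos Real.pi_pos hβ).ne'
  have hval : ∀ z, segalBargmann t (quadExp (1 / (2 * t) - β) l) z =
      A * pairKernel (s - t / 2) (t / 2) w z := by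
    intro z
    have hexp : Complex.exp (-(∑ k, z k ^ 2) / (2 * t)) *
        Complex.exp ((∑ k, (z k / t + l k) ^ 2) / (4 * β)) =
        Complex.exp ((∑ k, conj (w k) ^ 2) / (4 * β * t ^ 2)) *
          pairKernel (s - t / 2) (t / 2) w z := by
      rw [pairKernel, ← Complex.exp_add, ← Complex.exp_add]
      congr 1
      simp only [neg_div, Finset.sum_div, Finset.mul_sum, ← Finset.sum_neg_distrib,
        ← Finset.sum_add_distrib]
      refine Finset.sum_congr rfl fun k _ => ?_
      have h1 : (t : ℂ) ≠ 0 := by exact_mod_cast ht'.ne'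
      have h2 : (s : ℂ) ≠ 0 := by exact_mod_cast hs.ne'
      have h3 : (2 * s - t : ℂ) ≠ 0 := by
        have : 2 * s - t ≠ 0 := by linarith
        exact_mod_cast this
      have h4 : (s - t / 2 : ℂ) = (2 * s - t) / 2 := by ring
      simp only [hl, hβd]
      push_cast
      rw [h4]
      field_simp
      ring
    rw [segalBargmann_quadExp t hβ, heatKernel, hA]
    linear_combination (((2 * Real.pi * t) ^ (-(d : ℝ) / 2) : ℝ) : ℂ) *
      ((Real.pi / β : ℂ) ^ ((Fintype.card (Fin d) : ℂ) / 2)) * hexp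
  refine ⟨A⁻¹ • hf.toLp _, ?_⟩
  rw [map_smul]
  filter_upwards [Lp.coeFn_smul A⁻¹ (S (hf.toLp _)), hcyl] with C h1 h2
  rw [h1, Pi.smul_apply, h2, hval, smul_eq_mul, inv_mul_cancel_left₀ hA0]

lemma IsWhiteNoise.ae_eq_sum (hP : IsWhiteNoise s P) {φ : StrongDual ℝ (Abar V)} {c : Fin d → ℝ}
    (h : riesz (φ - ∑ k, c k • ℓ k) = 0) : ∀ᵐ A ∂P, φ A = ∑ k, c k * ℓ k A := by
  filter_upwards [hP.ae_eq_zero h] with A hA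
  have h1 : φ A - (∑ k, c k • ℓ k) A = 0 := hA
  rw [sub_eq_zero.1 h1]
  simp

/-- A linear combination of the functions `holomorphicChar` is a holomorphic cylinder function. -/
lemma exists_frame_of_mem_span_holomorphicChar (ht : 0 < t / 2)
    (hP' : IsWhiteNoise (s - t / 2) P') (hQ : IsWhiteNoise (t / 2) Q) {F : Lp ℂ 2 (P'.prod Q)}
    (hF : F ∈ Submodule.span ℂ
      (range fun φ => (memLp_holomorphicChar ht hP' hQ φ).toLp (holomorphicChar t φ))) :
    ∃ (d : ℕ) (e : Fin d → ConnL2 V) (ℓ : Fin d → (Abar V →L[ℝ] ℝ)) (Φ : (Fin d → ℂ) → ℂ),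
      IsFrame e ℓ ∧ Differentiable ℂ Φ ∧ F =ᵐ[P'.prod Q] fun C => Φ (frameEvalC ℓ C) := by
  have := hP'.1
  have := hQ.1
  obtain ⟨c, rfl⟩ := Finsupp.mem_span_range_iff_exists_finsupp.1 hF
  obtain ⟨d, e, ℓ, hℓ, hc⟩ := exists_frame fun i : c.support => (i : StrongDual ℝ (Abar V))
  choose m hm using hc
  refine ⟨d, e, ℓ, fun z => ∑ i : c.support, c i * Complex.exp
    (Complex.I * ∑ k, m i k * z k - (t / 2 * ‖riesz (i : StrongDual ℝ (Abar V))‖ ^ 2 : ℝ)),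
    hℓ, ?_, ?_⟩
  · fun_prop
  have h1 : ∀ᵐ C ∂P'.prod Q, ∀ i : c.support, i.1 C.1 = ∑ k, m i k * ℓ k C.1 :=
    ae_all_iff.2 fun i => Measure.quasiMeasurePreserving_fst.ae (hP'.ae_eq_sum (hm i))
  have h2 : ∀ᵐ C ∂P'.prod Q, ∀ i : c.support, i.1 C.2 = ∑ k, m i k * ℓ k C.2 :=
    ae_all_iff.2 fun i => Measure.quasiMeasurePreserving_snd.ae (hQ.ae_eq_sum (hm i))
  set v : StrongDual ℝ (Abar V) → Lp ℂ 2 (P'.prod Q) := fun φ =>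
    (memLp_holomorphicChar ht hP' hQ φ).toLp (holomorphicChar t φ) with hv
  have h3 : ∀ᵐ C ∂P'.prod Q, ∀ i : c.support, (c i • v i) C = c i * holomorphicChar t i C := by
    refine ae_all_iff.2 fun i => ?_
    filter_upwards [Lp.coeFn_smul (c i) (v i), (memLp_holomorphicChar ht hP' hQ i).coeFn_toLp]
      with C h4 h5
    rw [h4, Pi.smul_apply, h5, smul_eq_mul]
  have h4 : c.sum (fun φ a => a • v φ) = ∑ i : c.support, c i • v i :=
    (Finset.sum_coe_sort c.support fun φ => c φ • v φ).symm
  rw [h4]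
  filter_upwards [h1, h2, h3, Lp.coeFn_finsetSum Finset.univ (fun i : c.support => c i • v i)]
    with C h1 h2 h3 h4
  rw [h4, Finset.sum_apply]
  refine Finset.sum_congr rfl fun i _ => ?_
  rw [h3, holomorphicChar, h1, h2]
  congr 4
  simp only [frameEvalC, mul_add, Finset.sum_add_distrib]
  push_cast
  simp only [Finset.mul_sum]
  congr 1
  exact Finset.sum_congr rfl fun k _ => by ring

/-- The image of the transform is the holomorphic subspace. -/
theorem range_eq_holomorphicL2 (ht : 0 < t / 2) (hst : t / 2 < s) (hP : IsWhiteNoise s P)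
    (hP' : IsWhiteNoise (s - t / 2) P') (hQ : IsWhiteNoise (t / 2) Q) [IsFiniteMeasure P]
    {S : Lp ℂ 2 P →ₗᵢ[ℂ] Lp ℂ 2 (P'.prod Q)}
    (hS : ∀ φ, S (charLp P φ) = (memLp_holomorphicChar ht hP' hQ φ).toLp _)
    (hrange : range S = closure (Submodule.span ℂ
      (range fun φ => (memLp_holomorphicChar ht hP' hQ φ).toLp (holomorphicChar t φ)) :
        Set (Lp ℂ 2 (P'.prod Q)))) :
    range S = holomorphicL2 (P'.prod Q) := by
  refine Subset.antisymm ?_ ?_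
  · rw [hrange]
    exact closure_mono fun F hF => exists_frame_of_mem_span_holomorphicChar ht hP' hQ hF
  · have hcl : IsClosed (range S) := hrange ▸ isClosed_closure
    refine closure_minimal ?_ hcl
    rintro G ⟨d, e, ℓ, Φ, hℓ, hΦ, hG⟩
    choose f hf using exists_apply_eq_pairKernel ht hst hP hP' hQ hS hℓ
    have hmem := hℓ.mem_closure_span_pairKernel (sub_pos.2 hst) ht hP' hQ hf hΦ hG
    have hle : (Submodule.span ℂ (range fun w => S (f w))).topologicalClosure ≤
        LinearMap.range S.toLinearMap := by
      refine Submodule.topologicalClosure_minimal _ (Submodule.span_le.2 ?_) hcl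
      rintro _ ⟨w, rfl⟩
      exact ⟨f w, rfl⟩
    exact hle hmem

/-- Every character agrees almost everywhere with a cylinder function. -/
lemma exists_charLp_eq_toLp (hP : IsWhiteNoise s P) [IsFiniteMeasure P]
    (φ : StrongDual ℝ (Abar V)) :
    ∃ (d : ℕ) (e : Fin d → ConnL2 V) (ℓ : Fin d → (Abar V →L[ℝ] ℝ)) (g : (Fin d → ℝ) → ℂ)
      (hf : MemLp (fun A => g (frameEval ℓ A)) 2 P),
      IsFrame e ℓ ∧ Measurable g ∧ charLp P φ = hf.toLp _ := by
  obtain ⟨d, e, ℓ, hℓ, hc⟩ := exists_frame fun _ : Unit => φ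
  obtain ⟨c, hc⟩ := hc ()
  set g : (Fin d → ℝ) → ℂ := fun x => Complex.exp ((∑ k, c k * x k : ℝ) * Complex.I) with hg
  have hae : (probCharDual φ : Abar V → ℂ) =ᵐ[P] fun A => g (frameEval ℓ A) := by
    filter_upwards [hP.ae_eq_sum hc] with A hA
    rw [probCharDual_apply, hA, hg]
    rfl
  refine ⟨d, e, ℓ, g, (memLp_probCharDual P φ).ae_eq hae, hℓ, by fun_prop, ?_⟩
  exact MemLp.toLp_congr _ _ hae

end Range

end WienerSB

end

open WienerSB in
theorem theorem4p3 {𝔨 : Type*} [NormedAddCommGroup 𝔨] [InnerProductSpace ℝ 𝔨]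
    [FiniteDimensional ℝ 𝔨] (s t : ℝ) (ht : 0 < t / 2) (hst : t / 2 < s) :
    (∃! P : Measure (Abar 𝔨), IsWhiteNoise s P) ∧
    (∃! M : Measure (AbarC 𝔨), IsComplexWhiteNoise s t M) ∧
    ∀ (P : Measure (Abar 𝔨)) (M : Measure (AbarC 𝔨)),
      IsWhiteNoise s P → IsComplexWhiteNoise s t M →
      ∃! S : Lp ℂ 2 P →ₗᵢ[ℂ] Lp ℂ 2 M,
        Set.range S = holomorphicL2 M ∧
        ∀ (d : ℕ) (e : Fin d → ConnL2 𝔨) (ℓ : Fin d → (Abar 𝔨 →L[ℝ] ℝ)), IsFrame e ℓ →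
          ∀ φ : (Fin d → ℝ) → ℂ, Measurable φ →
            ∀ hf : MemLp (fun A => φ (frameEval ℓ A)) 2 P,
              S (hf.toLp _) =ᵐ[M] fun C => segalBargmann t φ (frameEvalC ℓ C) := by
  obtain ⟨P₀, hP₀⟩ := exists_isWhiteNoise (V := 𝔨) (ht.trans hst)
  obtain ⟨P', hP'⟩ := exists_isWhiteNoise (V := 𝔨) (sub_pos.2 hst)
  obtain ⟨Q, hQ⟩ := exists_isWhiteNoise (V := 𝔨) ht
  have hiff := isComplexWhiteNoise_iff hP' hQ
  refine ⟨⟨P₀, hP₀, fun P hP => hP.unique hP₀⟩,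
    ⟨P'.prod Q, (hiff _).2 rfl, fun M hM => (hiff M).1 hM⟩, fun P M hP hM => ?_⟩
  obtain rfl := (hiff M).1 hM
  have := hP.1
  obtain ⟨S, hS, hrange⟩ := exists_linearIsometry_of_inner_eq (charLp P)
    (fun φ => (memLp_holomorphicChar ht hP' hQ φ).toLp (holomorphicChar t φ))
    (inner_holomorphicChar ht hP hP' hQ) (topologicalClosure_span_charLp P)
  have hcyl := fun (d : ℕ) (e : Fin d → ConnL2 𝔨) (ℓ : Fin d → (Abar 𝔨 →L[ℝ] ℝ))
    (hℓ : IsFrame e ℓ) (φ : (Fin d → ℝ) → ℂ) (hφ : Measurable φ)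
    (hf : MemLp (fun A => φ (frameEval ℓ A)) 2 P) => apply_cylinder ht hst hP hP' hQ hS hℓ hφ hf
  refine ⟨S, ⟨range_eq_holomorphicL2 ht hst hP hP' hQ hS hrange, hcyl⟩, ?_⟩
  rintro S' ⟨-, hS'⟩
  have hd : Dense (Submodule.span ℂ (range (charLp P)) : Set (Lp ℂ 2 P)) :=
    Submodule.dense_iff_topologicalClosure_eq_top.2 (topologicalClosure_span_charLp P)
  have heq : S'.toContinuousLinearMap = S.toContinuousLinearMap := by
    refine ContinuousLinearMap.ext_on hd ?_
    rintro _ ⟨φ, rfl⟩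
    obtain ⟨d, e, ℓ, g, hf, hℓ, hg, hφ⟩ := exists_charLp_eq_toLp hP φ
    rw [hφ]
    exact Lp.ext ((hS' d e ℓ hℓ g hg hf).trans (hcyl d e ℓ hℓ g hg hf).symm)
  exact LinearIsometry.ext fun f => DFunLike.congr_fun heq f
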